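/- Let $X$ be a random variable with values in $\{0,\dots,N\}$, $\theta_j=\mathbb P\{X=j\}$, and assume that $m=\mathbb E(X)=\sum_{k=1}^N k\,\theta_k>1$. Consider the Galton–Watson tree in which each node has, independently of all other nodes, a random number of children with the law of $X$. Let $F_\tau$ be its Gromov boundary, i.e. the set of infinite descending paths starting at the root, with the metric $d(x,y)=2^{-|x\wedge y|}$ for $x\ne y$ (and $d(x,x)=0$), where $|x\wedge y|$ is the level of the last common node of $x$ and $y$. For a metric space $F$ and $r>0$ let $N_r(F)$ be the minimal number of closed balls of radius $r$ needed to cover $F$. For a function $\phi$ let $$\dim_A^{\phi}F=\inf\Big\{s\in\mathbb R:\ (\exists C>0)(\forall\, 0<r=R^{1+\phi(R)}<R<1)\ \ \sup_{x\in F}N_r(F\cap B(x,R))\le C\Big(\frac Rr\Big)^s\Big\},$$ where $B(x,R)$ is the closed ball. We call $\phi$ a dimension function if, on some interval $(0,\delta)$ with $\delta>0$, $\phi$ is positive and both $\phi(x)$ and $\phi(x)|\log x|$ are monotone. Let $\phi$ be a dimension function with $\phi(x)=\omega\big(\log|\log x|/|\log x|\big)$ as $x\to0^+$, that is, $\dfrac{\log|\log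 x|}{|\log x|\,\phi(x)}\to0$ as $x\to 0^+$. Then, almost surely, on the event that the tree is infinite (non-extinction), the box-counting dimension $\dim_B F_\tau=\lim_{r\to0}\log N_r(F_\tau)/(-\log r)$ exists (the lower and upper box-counting dimensions coincide) and $$\dim_A^{\phi}F_\tau=\dim_B F_\tau=\dim_H F_\tau .$$ -/

import Mathlib

open MeasureTheory ProbabilityTheory Filter Topology Asymptotics
open scoped NNReal ENNReal

/- The space of infinite words, with the metric `d(x, y) = 2 ^ (-|x ∧ y|)`, where `|x ∧ y|` is the
length of the longest common prefix of `x ≠ y` (`PiNat.firstDiff x y`). -/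
attribute [local instance] PiNat.metricSpaceNatNat

/-- `φ` is a dimension function: `φ(x)` and `φ(x)|log x|` are monotone (each of them
nondecreasing or nonincreasing) and `φ` is positive, near the origin. Only the behaviour as
`x → 0` matters, and functions such as `log|log x| / |log x|` have the required properties only on
a neighbourhood of the origin. -/
def IsDimensionFunction (φ : ℝ → ℝ) : Prop :=
  ∃ δ : ℝ, 0 < δ ∧ (∀ x ∈ Set.Ioo 0 δ, 0 < φ x) ∧
    (MonotoneOn φ (Set.Ioo 0 δ) ∨ AntitoneOn φ (Set.Ioo 0 δ)) ∧
    (MonotoneOn (fun x => φ x * |Real.log x|) (Set.Ioo 0 δ) ∨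
      AntitoneOn (fun x => φ x * |Real.log x|) (Set.Ioo 0 δ))

section Dimensions

variable {E : Type*} [PseudoMetricSpace E]

/-- `N_r(A)`: the minimal number of closed balls of radius `r` (with arbitrary centres in the space)
that cover `A`, equal to `∞` if no finite number suffices. -/
noncomputable def coverCount (r : ℝ) (A : Set E) : ℝ≥0∞ :=
  ((Metric.externalCoveringNumber r.toNNReal A : ℕ∞) : ℝ≥0∞)

/-- The `φ`-Assouad dimension (generalised Assouad spectrum) of `F`: the infimum of the exponents
`s` for which there is `C > 0` such that `sup_{x ∈ F} N_r(F ∩ B(x, R)) ≤ C (R / r) ^ s` whenever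
`0 < r = R ^ (1 + φ(R)) < R < 1`. -/
noncomputable def phiAssouadDim (φ : ℝ → ℝ) (F : Set E) : EReal :=
  sInf ((fun s : ℝ => (s : EReal)) '' {s : ℝ | ∃ C : ℝ, 0 < C ∧
    ∀ R r : ℝ, 0 < r → r = R ^ (1 + φ R) → r < R → R < 1 →
      ⨆ x ∈ F, coverCount r (F ∩ Metric.closedBall x R) ≤ ENNReal.ofReal (C * (R / r) ^ s)})

/-- The upper box-counting dimension `limsup_{r → 0} log N_r(F) / (-log r)`. -/
noncomputable def upperBoxDim (F : Set E) : EReal :=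
  limsup (fun r : ℝ => ENNReal.log (coverCount r F) / ((-Real.log r : ℝ) : EReal)) (𝓝[>] 0)

/-- The lower box-counting dimension `liminf_{r → 0} log N_r(F) / (-log r)`. -/
noncomputable def lowerBoxDim (F : Set E) : EReal :=
  liminf (fun r : ℝ => ENNReal.log (coverCount r F) / ((-Real.log r : ℝ) : EReal)) (𝓝[>] 0)

end Dimensions

/-- The tree of finite words in which the node `v` has the `c v` children
`v0, v1, …, v(c v - 1)`; the root is the empty word. -/
def familyTree (c : List ℕ → ℕ) : Set (List ℕ) :=
  {u | ∀ (i : ℕ) (hi : i < u.length), u[i] < c (u.take i)}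

/-- `Z_k`: the number of nodes of the tree at level `k`. -/
noncomputable def generationSize (c : List ℕ → ℕ) (k : ℕ) : ℕ∞ :=
  Set.encard {u | u ∈ familyTree c ∧ u.length = k}

/-- The Gromov boundary of the tree: its infinite descending paths starting at the root. -/
def gromovBoundary (c : List ℕ → ℕ) : Set (ℕ → ℕ) :=
  {x | ∀ n : ℕ, List.ofFn (fun i : Fin n => x i) ∈ familyTree c}

/-! All the dimensions equal `logb 2 m`, and each half of this rests on one almost sure statement
about the tree.

Upper bounds. For `b > m` the generating function satisfies `f (exp y) ≤ exp (b * y)` for small `y ≥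
0`. Iterating it gives an exponential tail for (size of generation `l`) / `b ^ l`, uniformly in `l`.
A union bound over all words and Borel–Cantelli then show that every node `u` has at most `C * (|u|
+ l + 1) * b ^ l` descendants `l` generations below (`ae_exists_genCount_descTree_le`). In the
ultrametric, balls are cylinders, so this bounds `N_r (F ∩ B(x, R))` with `|u| ≈ log₂ (1 / R)` and
`l ≈ log₂ (R / r)`. The growth condition on `φ` says that `log |log R|` is negligible against `log
(R / r)`, so the factor `|u|` costs only `(R / r) ^ ε`.

Lower bounds. Give a node `u` the weight `a ^ |u|` with `a = 2 ^ (-s)`, and let the content be the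
least weight of a cutset. For `a * m > 1` a second moment estimate keeps the mean content away from
`0`, so it vanishes with probability below `1`. That probability is a fixed point of `f`, and so is
the one for `a = 1`. A supercritical `f` has at most one fixed point in `[0, 1)`, hence on survival
the content is almost surely positive (`ae_minContent_ne_zero`). Every cover of the boundary yields
a cutset (`minContent_le_tsum`), which bounds the Hausdorff and lower box dimensions below by `s`.
The `φ`-Assouad dimension is bounded below by composing covers along the scales `R ↦ R ^ (1 + φ R)`
(`le_phiAssouadDim`). -/

/-! ### The Galton–Watson law and the branching property -/

/-- The offspring function of the subtree rooted at the `i`-th child of the root. -/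
def childTree (c : List ℕ → ℕ) (i : ℕ) : List ℕ → ℕ := fun v => c (i :: v)

/-- The offspring function of the subtree rooted at the node `u`. -/
def descTree (c : List ℕ → ℕ) (u : List ℕ) : List ℕ → ℕ := fun v => c (u ++ v)

/-- The law of the offspring function of a Galton–Watson tree with offspring distribution `θ`. -/
noncomputable def gwMeasure (θ : PMF ℕ) : Measure (List ℕ → ℕ) :=
  Measure.infinitePi fun _ => θ.toMeasure

instance (θ : PMF ℕ) : IsProbabilityMeasure (gwMeasure θ) := by
  unfold gwMeasure; infer_instance

@[fun_prop]
lemma measurable_childTree (i : ℕ) : Measurable fun c : List ℕ → ℕ => childTree c i :=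
  measurable_pi_lambda _ fun v => measurable_pi_apply (i :: v)

@[fun_prop]
lemma measurable_descTree (u : List ℕ) : Measurable fun c : List ℕ → ℕ => descTree c u :=
  measurable_pi_lambda _ fun v => measurable_pi_apply (u ++ v)

lemma measurePreserving_descTree (θ : PMF ℕ) (u : List ℕ) :
    MeasurePreserving (fun c => descTree c u) (gwMeasure θ) (gwMeasure θ) :=
  ⟨measurable_descTree u, Measure.map_infinitePi_infinitePi_of_inj
    (P := fun _ : List ℕ => θ.toMeasure) (List.append_right_injective u)⟩

/-- The tree with `p.1` children at the root and with the subtrees `p.2`. -/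
def graft (p : ℕ × (ℕ → List ℕ → ℕ)) : List ℕ → ℕ
  | [] => p.1
  | i :: v => p.2 i v

lemma measurable_graft : Measurable graft := by
  refine measurable_pi_lambda _ fun v => ?_
  cases v with
  | nil => exact measurable_fst
  | cons i v =>
    exact (measurable_pi_apply v).comp ((measurable_pi_apply i).comp measurable_snd)

/-- It suffices to test finite-dimensional boxes. Such a box splits into a condition at the empty
word and conditions at words `i :: v`; currying turns the latter into a box over pairs `(i, v)`. -/
lemma map_graft (θ : PMF ℕ) :
    (θ.toMeasure.prod (Measure.infinitePi fun _ : ℕ => gwMeasure θ)).map graft = gwMeasure θ := by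
  classical
  refine Measure.eq_infinitePi _ fun s t ht => ?_
  have hmeas : MeasurableSet (Set.pi (s : Set (List ℕ)) t) :=
    MeasurableSet.pi s.countable_toSet fun i _ => ht i
  rw [Measure.map_apply measurable_graft hmeas]
  let s' : Finset (ℕ × List ℕ) := s.preimage (fun p => p.1 :: p.2) (by
    rintro ⟨a, b⟩ _ ⟨a', b'⟩ _ h
    simpa using h)
  have hs' : ∀ i v, (i, v) ∈ s' ↔ i :: v ∈ s := fun i v => Finset.mem_preimage
  let A : Set ℕ := if [] ∈ s then t [] else Set.univ
  let B : Set (ℕ → List ℕ → ℕ) :=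
    (MeasurableEquiv.curry ℕ (List ℕ) ℕ).symm ⁻¹'
      Set.pi (s' : Set (ℕ × List ℕ)) (fun p => t (p.1 :: p.2))
  have hpre : graft ⁻¹' Set.pi (s : Set (List ℕ)) t = A ×ˢ B := by
    ext ⟨a, d⟩
    simp only [Set.mem_preimage, Set.mem_pi, Set.mem_prod, A, B]
    constructor
    · intro h
      refine ⟨?_, fun p hp => ?_⟩
      · split_ifs with h0
        · exact h [] h0
        · trivial
      · exact h (p.1 :: p.2) ((hs' p.1 p.2).1 hp)
    · rintro ⟨h0, h1⟩ v hv
      cases v with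
      | nil =>
        rw [if_pos (show [] ∈ s from hv)] at h0
        exact h0
      | cons i v => exact h1 (i, v) ((hs' i v).2 hv)
  have hB : (Measure.infinitePi fun _ : ℕ => gwMeasure θ) B
      = ∏ p ∈ s', θ.toMeasure (t (p.1 :: p.2)) := by
    have h := Measure.infinitePi_map_curry_symm (fun (_ : ℕ) (_ : List ℕ) => θ.toMeasure)
    have hm : MeasurableSet (Set.pi (s' : Set (ℕ × List ℕ)) (fun p => t (p.1 :: p.2))) :=
      MeasurableSet.pi s'.countable_toSet fun i _ => ht _
    rw [← Measure.infinitePi_pi (μ := fun _ : ℕ × List ℕ => θ.toMeasure) (fun _ _ => ht _), ← h,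
      Measure.map_apply (MeasurableEquiv.measurable _) hm]
    rfl
  have hA : θ.toMeasure A = if [] ∈ s then θ.toMeasure (t []) else 1 := by
    simp only [A]; split_ifs <;> simp
  rw [hpre, Measure.prod_prod, hB, hA]
  have hs : s = (if [] ∈ s then {[]} else ∅) ∪ s'.image (fun p => p.1 :: p.2) := by
    ext v
    cases v with
    | nil => by_cases h : [] ∈ s <;> simp [h]
    | cons i v => by_cases h : [] ∈ s <;> simp [h, hs']
  conv_rhs => rw [hs]
  rw [Finset.prod_union, Finset.prod_image]
  · split_ifs <;> simp
  · rintro ⟨a, b⟩ _ ⟨a', b'⟩ _ h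
    simpa using h
  · rw [Finset.disjoint_left]
    intro v hv hv'
    obtain ⟨p, _, rfl⟩ := Finset.mem_image.1 hv'
    split_ifs at hv
    · simp at hv
    · simp at hv

/-- Splitting a tree undoes `graft` definitionally, so `map_graft` can be read backwards. -/
lemma map_root_childTree (θ : PMF ℕ) :
    (gwMeasure θ).map (fun c => (c [], childTree c))
      = θ.toMeasure.prod (Measure.infinitePi fun _ : ℕ => gwMeasure θ) := by
  have hm : Measurable fun c : List ℕ → ℕ => (c [], childTree c) :=
    (measurable_pi_apply _).prodMk (measurable_pi_lambda _ fun i => measurable_childTree i)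
  conv_lhs => rw [← map_graft θ]
  rw [Measure.map_map hm measurable_graft]
  exact Measure.map_id

/-- The root and the subtrees of its children are independent. -/
lemma lintegral_root_eq_prod (θ : PMF ℕ) (j : ℕ) (g : ℕ → (List ℕ → ℕ) → ℝ≥0∞)
    (hg : ∀ i, Measurable (g i)) :
    ∫⁻ c, (if c [] = j then ∏ i ∈ Finset.range j, g i (childTree c i) else 0) ∂gwMeasure θ
      = θ j * ∏ i ∈ Finset.range j, ∫⁻ c, g i c ∂gwMeasure θ := by
  have hm : Measurable fun c : List ℕ → ℕ => (c [], childTree c) :=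
    (measurable_pi_apply _).prodMk (measurable_pi_lambda _ fun i => measurable_childTree i)
  have hprod : Measurable fun d : ℕ → List ℕ → ℕ => ∏ i ∈ Finset.range j, g i (d i) :=
    Finset.measurable_fun_prod _ fun i _ => (hg i).comp (measurable_pi_apply i)
  have hind : Measurable fun a : ℕ => (if a = j then 1 else 0 : ℝ≥0∞) := measurable_of_countable _
  have h1 : ∫⁻ c, (if c [] = j then ∏ i ∈ Finset.range j, g i (childTree c i) else 0) ∂gwMeasure θ
      = ∫⁻ p : ℕ × (ℕ → List ℕ → ℕ), (if p.1 = j then 1 else 0) *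
          ∏ i ∈ Finset.range j, g i (p.2 i)
          ∂(θ.toMeasure.prod (Measure.infinitePi fun _ : ℕ => gwMeasure θ)) := by
    rw [← map_root_childTree, lintegral_map _ hm]
    · refine lintegral_congr fun c => ?_
      split_ifs <;> simp
    · exact (hind.comp measurable_fst).mul (hprod.comp measurable_snd)
  rw [h1, lintegral_prod_mul hind.aemeasurable hprod.aemeasurable]
  congr 1
  · have : (fun a : ℕ => (if a = j then 1 else 0 : ℝ≥0∞)) = Set.indicator {j} 1 := by
      ext a; simp [Set.indicator_apply]
    rw [this, lintegral_indicator_one (measurableSet_singleton j),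
      PMF.toMeasure_apply_singleton _ _ (measurableSet_singleton j)]
  · have hindep : iIndepFun (fun i (d : ℕ → List ℕ → ℕ) => g i (d i))
        (Measure.infinitePi fun _ : ℕ => gwMeasure θ) := iIndepFun_infinitePi hg
    rw [lintegral_prod_eq_prod_lintegral_of_indepFun (Finset.range j)
      (fun i (d : ℕ → List ℕ → ℕ) => g i (d i)) hindep
      (fun i => (hg i).comp (measurable_pi_apply i))]
    refine Finset.prod_congr rfl fun i _ => ?_
    exact (measurePreserving_eval_infinitePi (fun _ : ℕ => gwMeasure θ) i).lintegral_comp (hg i)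

lemma measurable_root_dependent {β : Type*} [MeasurableSpace β] {F : ℕ → (List ℕ → ℕ) → β}
    (hF : ∀ j, Measurable (F j)) : Measurable fun c : List ℕ → ℕ => F (c []) c := by
  change Measurable (Function.uncurry F ∘ fun c => (c [], c))
  exact (measurable_from_prod_countable_right (f := Function.uncurry F) hF).comp
    ((measurable_pi_apply []).prodMk measurable_id)

lemma lintegral_root (θ : PMF ℕ) (F : ℕ → (List ℕ → ℕ) → ℝ≥0∞) (hF : ∀ j, Measurable (F j)) :
    ∫⁻ c, F (c []) c ∂gwMeasure θ
      = ∑' j, ∫⁻ c, (if c [] = j then F j c else 0) ∂gwMeasure θ := by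
  rw [← lintegral_tsum]
  · refine lintegral_congr fun c => ?_
    rw [tsum_eq_single (c [])]
    · simp
    · intro j hj
      simp [hj.symm]
  · intro j
    exact (Measurable.ite (measurable_pi_apply [] (measurableSet_singleton j)) (hF j)
      measurable_const).aemeasurable

/-- The branching property in generating function form. It serves both the fixed point equation of
the content and the exponential moments. -/
lemma lintegral_prod_children (θ : PMF ℕ) {g : (List ℕ → ℕ) → ℝ≥0∞} (hg : Measurable g) :
    ∫⁻ c, ∏ i ∈ Finset.range (c []), g (childTree c i) ∂gwMeasure θ
      = ∑' j, θ j * (∫⁻ c, g c ∂gwMeasure θ) ^ j := by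
  rw [lintegral_root θ (fun j c => ∏ i ∈ Finset.range j, g (childTree c i))
    (fun j => Finset.measurable_fun_prod _ fun i _ => hg.comp (measurable_childTree i))]
  refine tsum_congr fun j => ?_
  rw [lintegral_root_eq_prod θ j (fun _ => g) (fun _ => hg)]
  simp

lemma lintegral_root_eq_mul_childTree (θ : PMF ℕ) {g : (List ℕ → ℕ) → ℝ≥0∞} (hg : Measurable g)
    {i j : ℕ} (hij : i < j) :
    ∫⁻ c, (if c [] = j then g (childTree c i) else 0) ∂gwMeasure θ
      = θ j * ∫⁻ c, g c ∂gwMeasure θ := by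
  have h := lintegral_root_eq_prod θ j (fun k => if k = i then g else fun _ => 1)
    (fun k => by split_ifs; exacts [hg, measurable_const])
  have hi : i ∈ Finset.range j := Finset.mem_range.2 hij
  convert h using 2
  · ext c
    congr 1
    rw [Finset.prod_eq_single_of_mem i hi (fun k _ hk => by simp [hk])]
    simp
  · rw [Finset.prod_eq_single_of_mem i hi (fun k _ hk => by simp [hk])]
    simp

lemma lintegral_root_eq_mul_childTree₂ (θ : PMF ℕ) {g : (List ℕ → ℕ) → ℝ≥0∞} (hg : Measurable g)
    {i k j : ℕ} (hij : i < j) (hkj : k < j) (hik : i ≠ k) :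
    ∫⁻ c, (if c [] = j then g (childTree c i) * g (childTree c k) else 0) ∂gwMeasure θ
      = θ j * (∫⁻ c, g c ∂gwMeasure θ) ^ 2 := by
  have h := lintegral_root_eq_prod θ j (fun l => if l = i ∨ l = k then g else fun _ => 1)
    (fun l => by split_ifs; exacts [hg, measurable_const])
  have key : ∀ f : ℕ → ℝ≥0∞, (∀ l, l ≠ i ∧ l ≠ k → f l = 1) →
      ∏ l ∈ Finset.range j, f l = f i * f k := fun f hf =>
    Finset.prod_eq_mul_of_mem i k (Finset.mem_range.2 hij) (Finset.mem_range.2 hkj) hik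
      (fun l _ hl => hf l hl)
  convert h using 2
  · ext c
    congr 1
    rw [key]
    · simp
    · intro l hl; simp [hl.1, hl.2]
  · rw [key]
    · simp [sq]
    · intro l hl; simp [hl.1, hl.2]

/-! ### Minimal cutset content and its positivity on survival -/

/-- The minimum of `∑ a ^ |u|` over the cutsets of the tree above level `n`. -/
noncomputable def cutContent (a : ℝ≥0∞) : ℕ → (List ℕ → ℕ) → ℝ≥0∞
  | 0, _ => 1
  | n + 1, c => min 1 (a * ∑ i ∈ Finset.range (c []), cutContent a n (childTree c i))

/-- The infimum of `∑ a ^ |u|` over the finite cutsets of the tree. -/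
noncomputable def minContent (a : ℝ≥0∞) (c : List ℕ → ℕ) : ℝ≥0∞ := ⨅ n, cutContent a n c

lemma measurableSet_root_eq (j : ℕ) : MeasurableSet {c : List ℕ → ℕ | c [] = j} :=
  measurable_pi_apply (X := fun _ : List ℕ => ℕ) [] (measurableSet_singleton j)

lemma measurable_sum_children {f : (List ℕ → ℕ) → ℝ≥0∞} (hf : Measurable f) :
    Measurable fun c : List ℕ → ℕ => ∑ i ∈ Finset.range (c []), f (childTree c i) :=
  measurable_root_dependent fun j =>
    Finset.measurable_fun_sum (Finset.range j) fun i _ => hf.comp (measurable_childTree i)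

lemma measurable_cutContent (a : ℝ≥0∞) (n : ℕ) : Measurable (cutContent a n) := by
  induction n with
  | zero => exact measurable_const
  | succ n ih => exact measurable_const.min ((measurable_sum_children ih).const_mul a)

lemma measurable_minContent (a : ℝ≥0∞) : Measurable (minContent a) :=
  Measurable.iInf fun n => measurable_cutContent a n

lemma cutContent_le_one (a : ℝ≥0∞) (n : ℕ) (c : List ℕ → ℕ) : cutContent a n c ≤ 1 := by
  cases n with
  | zero => exact le_rfl
  | succ n => exact min_le_left _ _

lemma cutContent_succ_le (a : ℝ≥0∞) (n : ℕ) (c : List ℕ → ℕ) :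
    cutContent a (n + 1) c ≤ cutContent a n c := by
  induction n generalizing c with
  | zero => exact min_le_left _ _
  | succ n ih =>
    exact min_le_min le_rfl (mul_le_mul_right (Finset.sum_le_sum fun i _ => ih _) a)

lemma antitone_cutContent (a : ℝ≥0∞) (c : List ℕ → ℕ) : Antitone fun n => cutContent a n c :=
  antitone_nat_of_succ_le fun n => cutContent_succ_le a n c

lemma cutContent_mono {a b : ℝ≥0∞} (hab : a ≤ b) (n : ℕ) (c : List ℕ → ℕ) :
    cutContent a n c ≤ cutContent b n c := by
  induction n generalizing c with
  | zero => exact le_rfl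
  | succ n ih => exact min_le_min le_rfl (mul_le_mul' hab (Finset.sum_le_sum fun i _ => ih _))

lemma minContent_mono {a b : ℝ≥0∞} (hab : a ≤ b) (c : List ℕ → ℕ) :
    minContent a c ≤ minContent b c :=
  iInf_mono fun n => cutContent_mono hab n c

lemma minContent_le_one (a : ℝ≥0∞) (c : List ℕ → ℕ) : minContent a c ≤ 1 :=
  iInf_le_of_le 0 le_rfl

lemma tendsto_cutContent (a : ℝ≥0∞) (c : List ℕ → ℕ) :
    Tendsto (fun n => cutContent a n c) atTop (𝓝 (minContent a c)) :=
  tendsto_atTop_iInf (antitone_cutContent a c)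

lemma minContent_eq {a : ℝ≥0∞} (ha : a ≠ ∞) (c : List ℕ → ℕ) :
    minContent a c = min 1 (a * ∑ i ∈ Finset.range (c []), minContent a (childTree c i)) := by
  refine tendsto_nhds_unique ((tendsto_cutContent a c).comp (tendsto_add_atTop_nat 1)) ?_
  refine tendsto_const_nhds.min (ENNReal.Tendsto.const_mul ?_ (Or.inr ha))
  exact tendsto_finsetSum _ fun i _ => tendsto_cutContent a _

lemma minContent_eq_zero_iff {a : ℝ≥0∞} (ha : a ≠ ∞) (ha0 : a ≠ 0) (c : List ℕ → ℕ) :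
    minContent a c = 0 ↔ ∀ i < c [], minContent a (childTree c i) = 0 := by
  rw [minContent_eq ha]
  simp only [min_eq_iff, one_ne_zero, false_and, mul_eq_zero, ha0, false_or,
    Finset.sum_eq_zero_iff, Finset.mem_range]
  refine ⟨fun h => h.1, fun h => ⟨h, ?_⟩⟩
  rw [Finset.sum_eq_zero fun i hi => h i (Finset.mem_range.1 hi), mul_zero]
  exact zero_le_one

/-- The probability that the content vanishes is a fixed point of the generating function. -/
lemma measure_minContent_eq_zero (θ : PMF ℕ) {a : ℝ≥0∞} (ha : a ≠ ∞) (ha0 : a ≠ 0) :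
    gwMeasure θ {c | minContent a c = 0}
      = ∑' j, θ j * gwMeasure θ {c | minContent a c = 0} ^ j := by
  have hmeas : MeasurableSet {c | minContent a c = 0} :=
    measurable_minContent a (measurableSet_singleton 0)
  have h := lintegral_prod_children θ
    (g := Set.indicator {c | minContent a c = 0} 1) (measurable_one.indicator hmeas)
  rw [lintegral_indicator_one hmeas] at h
  rw [← h, ← lintegral_indicator_one hmeas]
  refine lintegral_congr fun c => ?_
  simp only [Set.indicator_apply, Set.mem_ofPred_eq, minContent_eq_zero_iff ha ha0 c, Pi.one_apply]
  split_ifs with hc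
  · rw [Finset.prod_eq_one]
    intro i hi
    rw [if_pos (hc i (Finset.mem_range.1 hi))]
  · push Not at hc
    obtain ⟨i, hi, hi0⟩ := hc
    rw [Finset.prod_eq_zero (Finset.mem_range.2 hi) (if_neg hi0)]

/-- Truncating a sum of numbers in `[0, 1]` at a level above `1` costs at most a multiple of the
sum of the products of pairs. -/
lemma sum_le_min_add_offDiag {ι : Type*} [DecidableEq ι] (s : Finset ι) (x : ι → ℝ)
    (h0 : ∀ i, 0 ≤ x i) (h1 : ∀ i, x i ≤ 1) {a : ℝ} (ha0 : 0 < a) (ha1 : a < 1) :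
    a * ∑ i ∈ s, x i ≤ min 1 (a * ∑ i ∈ s, x i)
      + a / (1 - a) * ∑ p ∈ s.offDiag, x p.1 * x p.2 := by
  have ha : 0 < 1 - a := by linarith
  set S := ∑ i ∈ s, x i with hS
  set Q := ∑ p ∈ s.offDiag, x p.1 * x p.2 with hQ
  have hQ0 : 0 ≤ Q := Finset.sum_nonneg fun p _ => mul_nonneg (h0 _) (h0 _)
  rcases le_total (a * S) 1 with h | h
  · rw [min_eq_right h]
    have : 0 ≤ a / (1 - a) * Q := by positivity
    linarith
  · rw [min_eq_left h]
    have hsq : S * S = ∑ p ∈ s.diag, x p.1 * x p.2 + Q := by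
      rw [hS, Finset.sum_mul_sum, ← Finset.sum_product', ← Finset.diag_union_offDiag,
        Finset.sum_union (Finset.disjoint_diag_offDiag s)]
    have hdiag : ∑ p ∈ s.diag, x p.1 * x p.2 ≤ S := by
      rw [Finset.sum_diag, hS]
      exact Finset.sum_le_sum fun i _ => mul_le_of_le_one_left (h0 i) (h1 i)
    have hS0 : 0 ≤ S := Finset.sum_nonneg fun i _ => h0 i
    -- Multiply `1 ≤ a * S` by `S`. Combined with `S * S ≤ S + Q` this gives `(1 - a) * S ≤ a * Q`,
    -- so the error term alone dominates `S`.
    have h2 : S ≤ a * (S * S) := by nlinarith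
    have h3 : (1 - a) * S ≤ a * Q := by nlinarith
    have h4 : S ≤ a / (1 - a) * Q := by
      rw [div_mul_eq_mul_div, le_div_iff₀ ha]
      linarith
    nlinarith

lemma ennreal_sum_le_min_add_offDiag {ι : Type*} [DecidableEq ι] (s : Finset ι) (x : ι → ℝ≥0∞)
    (h1 : ∀ i, x i ≤ 1) {a : ℝ} (ha0 : 0 < a) (ha1 : a < 1) :
    ENNReal.ofReal a * ∑ i ∈ s, x i ≤ min 1 (ENNReal.ofReal a * ∑ i ∈ s, x i)
      + ENNReal.ofReal (a / (1 - a)) * ∑ p ∈ s.offDiag, x p.1 * x p.2 := by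
  have ha : 0 < 1 - a := by linarith
  have hx : ∀ i, x i = ENNReal.ofReal (x i).toReal := fun i =>
    (ENNReal.ofReal_toReal ((h1 i).trans_lt ENNReal.one_lt_top).ne).symm
  have hsum : ∑ i ∈ s, x i = ENNReal.ofReal (∑ i ∈ s, (x i).toReal) := by
    rw [ENNReal.ofReal_sum_of_nonneg fun i _ => ENNReal.toReal_nonneg]
    exact Finset.sum_congr rfl fun i _ => hx i
  have hprod : ∑ p ∈ s.offDiag, x p.1 * x p.2
      = ENNReal.ofReal (∑ p ∈ s.offDiag, (x p.1).toReal * (x p.2).toReal) := by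
    rw [ENNReal.ofReal_sum_of_nonneg
      fun i _ => mul_nonneg ENNReal.toReal_nonneg ENNReal.toReal_nonneg]
    refine Finset.sum_congr rfl fun p _ => ?_
    rw [ENNReal.ofReal_mul ENNReal.toReal_nonneg, ← hx, ← hx]
  rw [hsum, hprod, ← ENNReal.ofReal_mul ha0.le, ← ENNReal.ofReal_mul (by positivity),
    ← ENNReal.ofReal_one, ← ENNReal.ofReal_min, ← ENNReal.ofReal_add]
  · refine ENNReal.ofReal_le_ofReal ?_
    refine sum_le_min_add_offDiag s (fun i => (x i).toReal) (fun i => ENNReal.toReal_nonneg) ?_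
      ha0 ha1
    intro i
    simpa using ENNReal.toReal_mono ENNReal.one_ne_top (h1 i)
  · refine le_min zero_le_one (mul_nonneg ha0.le (Finset.sum_nonneg fun i _ => ?_))
    exact ENNReal.toReal_nonneg
  · exact mul_nonneg (by positivity)
      (Finset.sum_nonneg fun i _ => mul_nonneg ENNReal.toReal_nonneg ENNReal.toReal_nonneg)

lemma lintegral_sum_children (θ : PMF ℕ) {f : (List ℕ → ℕ) → ℝ≥0∞} (hf : Measurable f) :
    ∫⁻ c, ∑ i ∈ Finset.range (c []), f (childTree c i) ∂gwMeasure θ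
      = (∑' j, θ j * j) * ∫⁻ c, f c ∂gwMeasure θ := by
  rw [lintegral_root θ (fun j c => ∑ i ∈ Finset.range j, f (childTree c i))
    (fun j => Finset.measurable_fun_sum _ fun i _ => hf.comp (measurable_childTree i)),
    ← ENNReal.tsum_mul_right]
  refine tsum_congr fun j => ?_
  have : ∀ c : List ℕ → ℕ, (if c [] = j then ∑ i ∈ Finset.range j, f (childTree c i) else 0)
      = ∑ i ∈ Finset.range j, if c [] = j then f (childTree c i) else 0 := by
    intro c; split_ifs <;> simp
  simp_rw [this]
  rw [lintegral_finsetSum]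
  · rw [Finset.sum_congr rfl fun i hi =>
      lintegral_root_eq_mul_childTree θ hf (Finset.mem_range.1 hi)]
    simp only [Finset.sum_const, Finset.card_range, nsmul_eq_mul]
    ring
  · intro i _
    exact Measurable.ite (measurableSet_root_eq j)
      (hf.comp (measurable_childTree i)) measurable_const

lemma lintegral_sum_offDiag_children (θ : PMF ℕ) {N : ℕ} (hθ : ∀ j, N < j → θ j = 0)
    {f : (List ℕ → ℕ) → ℝ≥0∞} (hf : Measurable f) :
    ∫⁻ c, ∑ p ∈ (Finset.range (c [])).offDiag, f (childTree c p.1) * f (childTree c p.2)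
      ∂gwMeasure θ ≤ (N : ℝ≥0∞) ^ 2 * (∫⁻ c, f c ∂gwMeasure θ) ^ 2 := by
  have hm : ∀ p : ℕ × ℕ, Measurable fun c => f (childTree c p.1) * f (childTree c p.2) :=
    fun p => (hf.comp (measurable_childTree _)).mul (hf.comp (measurable_childTree _))
  rw [lintegral_root θ (fun j c => ∑ p ∈ (Finset.range j).offDiag,
      f (childTree c p.1) * f (childTree c p.2))
    (fun j => Finset.measurable_fun_sum _ fun p _ => hm p)]
  have hj : ∀ j, ∫⁻ c, (if c [] = j then ∑ p ∈ (Finset.range j).offDiag,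
      f (childTree c p.1) * f (childTree c p.2) else 0) ∂gwMeasure θ
      ≤ θ j * ((N : ℝ≥0∞) ^ 2 * (∫⁻ c, f c ∂gwMeasure θ) ^ 2) := by
    intro j
    have : ∀ c : List ℕ → ℕ, (if c [] = j then ∑ p ∈ (Finset.range j).offDiag,
        f (childTree c p.1) * f (childTree c p.2) else 0)
        = ∑ p ∈ (Finset.range j).offDiag,
          if c [] = j then f (childTree c p.1) * f (childTree c p.2) else 0 := by
      intro c; split_ifs <;> simp
    simp_rw [this]
    rw [lintegral_finsetSum]
    · rw [Finset.sum_congr rfl fun p hp => lintegral_root_eq_mul_childTree₂ θ hf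
        (Finset.mem_range.1 (Finset.mem_offDiag.1 hp).1)
        (Finset.mem_range.1 (Finset.mem_offDiag.1 hp).2.1) (Finset.mem_offDiag.1 hp).2.2]
      rw [Finset.sum_const, nsmul_eq_mul]
      rcases lt_or_ge N j with h | h
      · simp [hθ j h]
      · have hcard : (((Finset.range j).offDiag.card : ℕ) : ℝ≥0∞) ≤ (N : ℝ≥0∞) ^ 2 := by
          rw [Finset.offDiag_card, Finset.card_range]
          exact_mod_cast (Nat.sub_le _ _).trans ((Nat.mul_le_mul h h).trans_eq (sq N).symm)
        calc _ ≤ (N : ℝ≥0∞) ^ 2 * (θ j * (∫⁻ c, f c ∂gwMeasure θ) ^ 2) := by gcongr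
          _ = _ := by ring
    · intro p _
      exact Measurable.ite (measurableSet_root_eq j)
        (hm p) measurable_const
  refine (ENNReal.tsum_le_tsum hj).trans_eq ?_
  rw [ENNReal.tsum_mul_right, PMF.tsum_coe, one_mul]

/-- One step of the recursion sends a mean `I` to at least `a * m * I - D * I ^ 2`: truncation costs
only products over pairs of distinct children, which are independent and at most `N ^ 2` in number.
-/
lemma mean_mul_lintegral_le (θ : PMF ℕ) {N : ℕ} (hθ : ∀ j, N < j → θ j = 0)
    {f : (List ℕ → ℕ) → ℝ≥0∞} (hf : Measurable f) (hf1 : ∀ c, f c ≤ 1)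
    {a : ℝ} (ha0 : 0 < a) (ha1 : a < 1) :
    ENNReal.ofReal a * (∑' j, θ j * j) * ∫⁻ c, f c ∂gwMeasure θ
      ≤ ∫⁻ c, min 1 (ENNReal.ofReal a * ∑ i ∈ Finset.range (c []), f (childTree c i)) ∂gwMeasure θ
        + ENNReal.ofReal (a / (1 - a)) * ((N : ℝ≥0∞) ^ 2 * (∫⁻ c, f c ∂gwMeasure θ) ^ 2) := by
  rw [mul_assoc, ← lintegral_sum_children θ hf, ← lintegral_const_mul _ (measurable_sum_children hf)]
  refine (lintegral_mono fun c => ennreal_sum_le_min_add_offDiag (Finset.range (c []))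
    (fun i => f (childTree c i)) (fun i => hf1 _) ha0 ha1).trans ?_
  rw [lintegral_add_left (measurable_const.min ((measurable_sum_children hf).const_mul _))]
  gcongr
  rw [lintegral_const_mul]
  · gcongr
    exact lintegral_sum_offDiag_children θ hθ hf
  · exact measurable_root_dependent
      (F := fun j c => ∑ p ∈ (Finset.range j).offDiag, f (childTree c p.1) * f (childTree c p.2))
      fun j => Finset.measurable_fun_sum (Finset.range j).offDiag fun p _ =>
        (hf.comp (measurable_childTree _)).mul (hf.comp (measurable_childTree _))

/-- The expected content stays bounded away from zero. -/
lemma exists_le_lintegral_cutContent (θ : PMF ℕ) {N : ℕ} (hθ : ∀ j, N < j → θ j = 0)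
    {a m : ℝ} (ha0 : 0 < a) (ha1 : a < 1) (hm : ENNReal.ofReal m = ∑' j, θ j * j)
    (ham : 1 < a * m) :
    ∃ x : ℝ, 0 < x ∧ ∀ n, ENNReal.ofReal x ≤ ∫⁻ c, cutContent (ENNReal.ofReal a) n c ∂gwMeasure θ := by
  have ha : 0 < 1 - a := by linarith
  set D : ℝ := a / (1 - a) * (N : ℝ) ^ 2 with hD
  have hD0 : 0 ≤ D := by positivity
  have hx : 0 < (a * m - 1) / (D + 1) := div_pos (by linarith) (by linarith)
  -- This is exactly `x ≤ a * m * x - D * x ^ 2`, so the one-step bound preserves the level `x`.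
  obtain ⟨x, hx0, hx1, hxD⟩ : ∃ x : ℝ, 0 < x ∧ x ≤ 1 ∧ D * x ≤ a * m - 1 := by
    refine ⟨min 1 ((a * m - 1) / (D + 1)), lt_min one_pos hx, min_le_left _ _, ?_⟩
    calc D * min 1 ((a * m - 1) / (D + 1)) ≤ (D + 1) * ((a * m - 1) / (D + 1)) := by
          gcongr
          · linarith
          · exact min_le_right _ _
      _ = a * m - 1 := by field_simp
  refine ⟨x, hx0, fun n => ?_⟩
  induction n with
  | zero => simpa [cutContent] using hx1
  | succ n ih =>
    set I := ∫⁻ c, cutContent (ENNReal.ofReal a) n c ∂gwMeasure θ with hI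
    have hx0' : ENNReal.ofReal x ≠ 0 := by simpa using hx0
    have hI0 : I ≠ 0 := fun h => by rw [h] at ih; exact hx0' (le_antisymm ih bot_le)
    have hI1 : I ≤ 1 := by
      calc I ≤ ∫⁻ _, 1 ∂gwMeasure θ := lintegral_mono fun c => cutContent_le_one _ _ _
        _ = 1 := by simp
    have hItop : I ≠ ∞ := (hI1.trans_lt ENNReal.one_lt_top).ne
    -- The bound `a * m * I - D * I ^ 2` is not monotone in `I`, so the content is scaled down until
    -- its mean is exactly `x`. The recursion itself is monotone.
    set r : ℝ≥0∞ := ENNReal.ofReal x / I with hr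
    have hr1 : r ≤ 1 := ENNReal.div_le_of_le_mul (by rwa [one_mul])
    have hrI : r * I = ENNReal.ofReal x := ENNReal.div_mul_cancel hI0 hItop
    have hle : ∀ c, r * cutContent (ENNReal.ofReal a) n c ≤ cutContent (ENNReal.ofReal a) n c :=
      fun c => mul_le_of_le_one_left' hr1
    have hmc := measurable_cutContent (ENNReal.ofReal a) n
    have key := mean_mul_lintegral_le θ hθ (f := fun c => r * cutContent (ENNReal.ofReal a) n c)
      (hmc.const_mul r) (fun c => (hle c).trans (cutContent_le_one _ _ _)) ha0 ha1
    rw [lintegral_const_mul r hmc, hrI, ← hm] at key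
    have hmono : ∫⁻ c, min 1 (ENNReal.ofReal a * ∑ i ∈ Finset.range (c []),
          r * cutContent (ENNReal.ofReal a) n (childTree c i)) ∂gwMeasure θ
        ≤ ∫⁻ c, cutContent (ENNReal.ofReal a) (n + 1) c ∂gwMeasure θ :=
      lintegral_mono fun c => min_le_min le_rfl
        (mul_le_mul_right (Finset.sum_le_sum fun i _ => hle _) _)
    have key2 := key.trans (add_le_add_left hmono _)
    set J := ∫⁻ c, cutContent (ENNReal.ofReal a) (n + 1) c ∂gwMeasure θ with hJ
    have hJtop : J ≠ ∞ := by
      have : J ≤ ∫⁻ _, 1 ∂gwMeasure θ := lintegral_mono fun c => cutContent_le_one _ _ _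
      exact ne_top_of_le_ne_top (by simp) this
    have hJr : J = ENNReal.ofReal J.toReal := (ENNReal.ofReal_toReal hJtop).symm
    have hJ0 : 0 ≤ J.toReal := ENNReal.toReal_nonneg
    have hN : (N : ℝ≥0∞) = ENNReal.ofReal N := (ENNReal.ofReal_natCast N).symm
    rw [hJr, hN, ← ENNReal.ofReal_pow (by positivity), ← ENNReal.ofReal_pow hx0.le,
      ← ENNReal.ofReal_mul ha0.le, ← ENNReal.ofReal_mul (by linarith),
      ← ENNReal.ofReal_mul (by positivity), ← ENNReal.ofReal_mul (by positivity),
      ← ENNReal.ofReal_add hJ0 (by positivity), ENNReal.ofReal_le_ofReal_iff (by positivity)] at key2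
    rw [hJr]
    refine ENNReal.ofReal_le_ofReal ?_
    have h5 : a / (1 - a) * ((N : ℝ) ^ 2 * x ^ 2) = D * x * x := by rw [hD]; ring
    rw [h5] at key2
    nlinarith [mul_le_mul_of_nonneg_right hxD hx0.le]

lemma measure_minContent_eq_zero_lt_one (θ : PMF ℕ) {N : ℕ} (hθ : ∀ j, N < j → θ j = 0)
    {a m : ℝ} (ha0 : 0 < a) (ha1 : a < 1) (hm : ENNReal.ofReal m = ∑' j, θ j * j)
    (ham : 1 < a * m) :
    gwMeasure θ {c | minContent (ENNReal.ofReal a) c = 0} < 1 := by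
  obtain ⟨x, hx0, hx⟩ := exists_le_lintegral_cutContent θ hθ ha0 ha1 hm ham
  have hint : ENNReal.ofReal x ≤ ∫⁻ c, minContent (ENNReal.ofReal a) c ∂gwMeasure θ := by
    unfold minContent
    rw [lintegral_iInf (fun n => measurable_cutContent _ n)
      (fun i j hij c => antitone_cutContent _ c hij) (by simp [cutContent])]
    exact le_iInf hx
  have hmeas : MeasurableSet {c | minContent (ENNReal.ofReal a) c = 0} :=
    measurable_minContent _ (measurableSet_singleton 0)
  refine lt_of_le_of_ne prob_le_one fun h => ?_
  have hae : ∀ᵐ c ∂gwMeasure θ, minContent (ENNReal.ofReal a) c = 0 :=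
    (prob_compl_eq_zero_iff hmeas).2 h
  rw [lintegral_congr_ae hae] at hint
  simp at hint
  linarith

/-- A supercritical generating function has at most one fixed point in `[0, 1)`. -/
lemma eq_of_generating_fixed {N : ℕ} (w : ℕ → ℝ) (hw : ∀ j, 0 ≤ w j)
    (hsum : ∑ j ∈ Finset.range (N + 1), w j = 1)
    (hmean : 1 < ∑ j ∈ Finset.range (N + 1), w j * j) {p q : ℝ} (hp : 0 ≤ p) (hpq : p ≤ q)
    (hq : q < 1) (hpf : ∑ j ∈ Finset.range (N + 1), w j * p ^ j = p)
    (hqf : ∑ j ∈ Finset.range (N + 1), w j * q ^ j = q) : p = q := by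
  by_contra hne
  have hlt : p < q := lt_of_le_of_ne hpq hne
  have hp1 : p < 1 := hlt.trans hq
  -- `q` is the convex combination of the fixed points `p` and `1` with weight `t`. Strict convexity
  -- puts the value of the generating function at `q` strictly below the chord, whose height there
  -- is `q`.
  set t : ℝ := (1 - q) / (1 - p) with ht
  have h1p : 0 < 1 - p := by linarith
  have ht0 : 0 < t := div_pos (by linarith) h1p
  have ht1 : 0 < 1 - t := by
    rw [ht, sub_pos, div_lt_one h1p]; linarith
  have hqt : q = t * p + (1 - t) * 1 := by
    rw [ht]; field_simp; ring
  -- Strictness needs a term of degree at least `2`; without one the mean would be at most `1`.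
  obtain ⟨j₀, hj₀, hj2, hwj⟩ : ∃ j ∈ Finset.range (N + 1), 2 ≤ j ∧ 0 < w j := by
    by_contra! hcon
    refine absurd hmean (not_lt.2 ?_)
    rw [← hsum]
    refine Finset.sum_le_sum fun j hj => ?_
    rcases lt_or_ge j 2 with h | h
    · have : (j : ℝ) ≤ 1 := by exact_mod_cast Nat.lt_succ_iff.1 h
      exact mul_le_of_le_one_right (hw j) this
    · have : w j = 0 := le_antisymm (hcon j hj h) (hw j)
      simp [this]
  have hlt' : ∑ j ∈ Finset.range (N + 1), w j * q ^ j
      < ∑ j ∈ Finset.range (N + 1), w j * (t * p ^ j + (1 - t) * 1) := by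
    refine Finset.sum_lt_sum (fun j _ => mul_le_mul_of_nonneg_left ?_ (hw j)) ⟨j₀, hj₀, ?_⟩
    · have := (convexOn_pow j (𝕜 := ℝ)).2 (Set.mem_Ici.2 hp) (Set.mem_Ici.2 zero_le_one) ht0.le
        ht1.le (by ring)
      simpa [hqt] using this
    · refine mul_lt_mul_of_pos_left ?_ hwj
      have := (strictConvexOn_pow (n := j₀) hj2).2 (Set.mem_Ici.2 hp) (Set.mem_Ici.2 zero_le_one)
        hp1.ne ht0 ht1 (by ring)
      simpa [hqt] using this
  have : ∑ j ∈ Finset.range (N + 1), w j * (t * p ^ j + (1 - t) * 1) = q := by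
    calc _ = t * ∑ j ∈ Finset.range (N + 1), w j * p ^ j
          + (1 - t) * ∑ j ∈ Finset.range (N + 1), w j := by
          rw [Finset.mul_sum, Finset.mul_sum, ← Finset.sum_add_distrib]
          exact Finset.sum_congr rfl fun j _ => by ring
      _ = q := by rw [hpf, hsum, hqt]
  linarith

lemma sum_toReal_eq_one (θ : PMF ℕ) {N : ℕ} (hθ : ∀ j, N < j → θ j = 0) :
    ∑ j ∈ Finset.range (N + 1), (θ j).toReal = 1 := by
  rw [← ENNReal.toReal_sum fun j _ => θ.apply_ne_top j, ← tsum_eq_sum (L := .unconditional _),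
    θ.tsum_coe, ENNReal.toReal_one]
  intro j hj
  exact hθ j (by simpa [Nat.lt_succ_iff] using hj)

lemma tsum_mul_eq_ofReal_sum (θ : PMF ℕ) {N : ℕ} (hθ : ∀ j, N < j → θ j = 0) {f : ℕ → ℝ}
    (hf : ∀ j, 0 ≤ f j) :
    ∑' j, θ j * ENNReal.ofReal (f j)
      = ENNReal.ofReal (∑ j ∈ Finset.range (N + 1), (θ j).toReal * f j) := by
  rw [ENNReal.ofReal_sum_of_nonneg fun j _ => mul_nonneg ENNReal.toReal_nonneg (hf j), tsum_eq_sum]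
  · refine Finset.sum_congr rfl fun j _ => ?_
    rw [ENNReal.ofReal_mul ENNReal.toReal_nonneg, ENNReal.ofReal_toReal (θ.apply_ne_top j)]
  · intro j hj
    rw [hθ j (by simpa [Nat.lt_succ_iff] using hj), zero_mul]

/-- Almost surely on survival the content is positive. -/
lemma ae_minContent_ne_zero (θ : PMF ℕ) {N : ℕ} (hθ : ∀ j, N < j → θ j = 0) {m : ℝ}
    (hm : m = ∑ j ∈ Finset.range (N + 1), (θ j).toReal * j) {a : ℝ} (ha0 : 0 < a) (ha1 : a < 1)
    (ham : 1 < a * m) :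
    ∀ᵐ c ∂gwMeasure θ, minContent 1 c ≠ 0 → minContent (ENNReal.ofReal a) c ≠ 0 := by
  have hm1 : 1 < m := by nlinarith
  have hmE : ENNReal.ofReal m = ∑' j, θ j * j := by
    rw [hm, ← tsum_mul_eq_ofReal_sum θ hθ fun j => Nat.cast_nonneg j]
    simp
  have ha0' : ENNReal.ofReal a ≠ 0 := by simpa using ha0
  have hsub : {c | minContent 1 c = 0} ⊆ {c | minContent (ENNReal.ofReal a) c = 0} := fun c hc =>
    le_antisymm ((minContent_mono (by simpa using ha1.le) c).trans_eq hc) bot_le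
  set p := gwMeasure θ {c | minContent 1 c = 0} with hp
  set q := gwMeasure θ {c | minContent (ENNReal.ofReal a) c = 0} with hq
  have hpq : p ≤ q := measure_mono hsub
  have hq1 : q < 1 := measure_minContent_eq_zero_lt_one θ hθ ha0 ha1 hmE ham
  have hqtop : q ≠ ∞ := (hq1.trans ENNReal.one_lt_top).ne
  have hptop : p ≠ ∞ := ne_top_of_le_ne_top hqtop hpq
  have hreal : ∀ r : ℝ≥0∞, r ≠ ∞ → r = ∑' j, θ j * r ^ j →
      ∑ j ∈ Finset.range (N + 1), (θ j).toReal * r.toReal ^ j = r.toReal := by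
    intro r hr h
    have h1 : ∀ j, r ^ j = ENNReal.ofReal (r.toReal ^ j) := fun j => by
      rw [ENNReal.ofReal_pow ENNReal.toReal_nonneg, ENNReal.ofReal_toReal hr]
    simp_rw [h1] at h
    rw [tsum_mul_eq_ofReal_sum θ hθ fun j => pow_nonneg ENNReal.toReal_nonneg j] at h
    conv_rhs => rw [h]
    rw [ENNReal.toReal_ofReal]
    exact Finset.sum_nonneg fun j _ => mul_nonneg ENNReal.toReal_nonneg
      (pow_nonneg ENNReal.toReal_nonneg j)
  have heq : p.toReal = q.toReal := eq_of_generating_fixed (fun j => (θ j).toReal)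
    (fun j => ENNReal.toReal_nonneg) (sum_toReal_eq_one θ hθ) (hm ▸ hm1) ENNReal.toReal_nonneg
    (ENNReal.toReal_mono hqtop hpq)
    (by simpa using (ENNReal.toReal_lt_toReal hqtop ENNReal.one_ne_top).2 hq1)
    (hreal p hptop (measure_minContent_eq_zero θ ENNReal.one_ne_top one_ne_zero))
    (hreal q hqtop (measure_minContent_eq_zero θ ENNReal.ofReal_ne_top ha0'))
  -- Nested events of equal finite measure agree almost everywhere.
  have heq' : p = q := (ENNReal.toReal_eq_toReal_iff' hptop hqtop).1 heq
  have hmeas : MeasurableSet {c | minContent 1 c = 0} :=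
    measurable_minContent 1 (measurableSet_singleton 0)
  have hae := ae_eq_of_subset_of_measure_ge hsub heq'.ge hmeas.nullMeasurableSet hqtop
  filter_upwards [hae] with c hc h1 h2
  exact h1 (hc.mpr h2)

/-! ### Exponential moments and uniform growth of generations -/

/-- The size of the `n`-th generation. -/
def genCount : ℕ → (List ℕ → ℕ) → ℕ
  | 0, _ => 1
  | n + 1, c => ∑ i ∈ Finset.range (c []), genCount n (childTree c i)

lemma measurable_genCount (n : ℕ) : Measurable (genCount n) := by
  induction n with
  | zero => exact measurable_const
  | succ n ih =>
    exact measurable_root_dependent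
      (F := fun j c => ∑ i ∈ Finset.range j, genCount n (childTree c i))
      fun j => Finset.measurable_fun_sum (Finset.range j) fun i _ =>
        ih.comp (measurable_childTree i)

lemma genCount_le_pow {N : ℕ} {c : List ℕ → ℕ} (hc : ∀ v, c v ≤ N) (n : ℕ) :
    genCount n c ≤ N ^ n := by
  induction n generalizing c with
  | zero => exact le_rfl
  | succ n ih =>
    calc genCount (n + 1) c ≤ ∑ i ∈ Finset.range (c []), N ^ n :=
          Finset.sum_le_sum fun i _ => ih fun v => hc (i :: v)
      _ = c [] * N ^ n := by simp
      _ ≤ N * N ^ n := by gcongr; exact hc []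
      _ = N ^ (n + 1) := by ring

lemma lintegral_exp_genCount_succ (θ : PMF ℕ) (x : ℝ) (n : ℕ) :
    ∫⁻ c, ENNReal.ofReal (Real.exp (x * genCount (n + 1) c)) ∂gwMeasure θ
      = ∑' j, θ j * (∫⁻ c, ENNReal.ofReal (Real.exp (x * genCount n c)) ∂gwMeasure θ) ^ j := by
  have hm : Measurable fun c => ENNReal.ofReal (Real.exp (x * genCount n c)) :=
    (measurable_of_countable fun k : ℕ => ENNReal.ofReal (Real.exp (x * k))).comp
      (measurable_genCount n)
  rw [← lintegral_prod_children θ hm]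
  refine lintegral_congr fun c => ?_
  rw [← ENNReal.ofReal_prod_of_nonneg fun i _ => (Real.exp_pos _).le, ← Real.exp_sum,
    ← Finset.mul_sum]
  simp [genCount]

/-- Each generation applies the generating function once, which multiplies the exponent by at most
`b`; `b ^ n * x ≤ y₀` keeps all iterates in the range of `hy`. -/
lemma lintegral_exp_genCount_le (θ : PMF ℕ) {b y₀ : ℝ} (hb : 1 ≤ b)
    (hy : ∀ y, 0 ≤ y → y ≤ y₀ →
      ∑' j, θ j * ENNReal.ofReal (Real.exp y) ^ j ≤ ENNReal.ofReal (Real.exp (b * y)))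
    {x : ℝ} (hx : 0 ≤ x) (n : ℕ) (hxn : b ^ n * x ≤ y₀) :
    ∫⁻ c, ENNReal.ofReal (Real.exp (x * genCount n c)) ∂gwMeasure θ
      ≤ ENNReal.ofReal (Real.exp (b ^ n * x)) := by
  induction n with
  | zero => simp [genCount]
  | succ n ih =>
    have hn : b ^ n * x ≤ y₀ := by
      refine le_trans ?_ hxn
      gcongr; omega
    rw [lintegral_exp_genCount_succ]
    refine (ENNReal.tsum_le_tsum fun j => mul_le_mul_right (pow_le_pow_left' (ih hn) j) _).trans ?_
    refine (hy _ (by positivity) hn).trans_eq ?_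
    congr 2
    ring

/-- Markov's inequality with the largest admissible exponent, `x = y₀ / b ^ n`. The resulting bound
does not depend on `n`. -/
lemma measure_lt_genCount_le (θ : PMF ℕ) {b y₀ : ℝ} (hb : 1 ≤ b) (hy₀ : 0 < y₀)
    (hy : ∀ y, 0 ≤ y → y ≤ y₀ →
      ∑' j, θ j * ENNReal.ofReal (Real.exp y) ^ j ≤ ENNReal.ofReal (Real.exp (b * y)))
    (n : ℕ) (t : ℝ) :
    gwMeasure θ {c | t * b ^ n < genCount n c} ≤ ENNReal.ofReal (Real.exp (y₀ - y₀ * t)) := by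
  have hbn : 0 < b ^ n := by positivity
  set x := y₀ / b ^ n with hx
  have hx0 : 0 < x := div_pos hy₀ hbn
  have hxn : b ^ n * x = y₀ := by rw [hx]; field_simp
  have hI := lintegral_exp_genCount_le θ hb hy hx0.le n hxn.le
  rw [hxn] at hI
  have hm : Measurable fun c => ENNReal.ofReal (Real.exp (x * genCount n c)) :=
    (measurable_of_countable fun k : ℕ => ENNReal.ofReal (Real.exp (x * k))).comp
      (measurable_genCount n)
  have hpos : ENNReal.ofReal (Real.exp (y₀ * t)) ≠ 0 := by simp [Real.exp_pos]
  calc gwMeasure θ {c | t * b ^ n < genCount n c}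
      ≤ gwMeasure θ {c | ENNReal.ofReal (Real.exp (y₀ * t))
          ≤ ENNReal.ofReal (Real.exp (x * genCount n c))} := by
        refine measure_mono fun c hc => ENNReal.ofReal_le_ofReal (Real.exp_le_exp.2 ?_)
        rw [← hxn]
        have := mul_le_mul_of_nonneg_left (le_of_lt (show t * b ^ n < genCount n c from hc)) hx0.le
        linarith
    _ ≤ (∫⁻ c, ENNReal.ofReal (Real.exp (x * genCount n c)) ∂gwMeasure θ)
          / ENNReal.ofReal (Real.exp (y₀ * t)) :=
        meas_ge_le_lintegral_div hm.aemeasurable hpos ENNReal.ofReal_ne_top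
    _ ≤ ENNReal.ofReal (Real.exp y₀) / ENNReal.ofReal (Real.exp (y₀ * t)) := by gcongr
    _ = ENNReal.ofReal (Real.exp (y₀ - y₀ * t)) := by
        rw [← ENNReal.ofReal_div_of_pos (Real.exp_pos _), Real.exp_sub]

/-- The logarithm of the generating function at `exp y` has slope `m < b` at `y = 0`. The two terms
of the minimum ensure `j * y ≤ 1`, for the quadratic estimate of `exp`, and that the quadratic error
is at most `(b - m) * y`. -/
lemma exists_generating_exp_le (θ : PMF ℕ) {N : ℕ} (hθ : ∀ j, N < j → θ j = 0) {m b : ℝ}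
    (hm : m = ∑ j ∈ Finset.range (N + 1), (θ j).toReal * j) (hb : m < b) :
    ∃ y₀ : ℝ, 0 < y₀ ∧ ∀ y, 0 ≤ y → y ≤ y₀ →
      ∑' j, θ j * ENNReal.ofReal (Real.exp y) ^ j ≤ ENNReal.ofReal (Real.exp (b * y)) := by
  have hN : (0 : ℝ) < (N : ℝ) + 1 := by positivity
  refine ⟨min (1 / (N + 1)) ((b - m) / (N + 1) ^ 2), lt_min (by positivity)
    (div_pos (by linarith) (by positivity)), fun y hy0 hy => ?_⟩
  have hy1 : y * (N + 1) ≤ 1 := by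
    rw [← le_div_iff₀ hN]; exact hy.trans (min_le_left _ _)
  have hy2 : y * (N + 1) ^ 2 ≤ b - m := by
    rw [← le_div_iff₀ (by positivity)]; exact hy.trans (min_le_right _ _)
  have h1 : ∀ j : ℕ, ENNReal.ofReal (Real.exp y) ^ j = ENNReal.ofReal (Real.exp (j * y)) := by
    intro j
    rw [← ENNReal.ofReal_pow (Real.exp_pos _).le, ← Real.exp_nat_mul]
  simp_rw [h1]
  rw [tsum_mul_eq_ofReal_sum θ hθ fun j => (Real.exp_pos _).le]
  refine ENNReal.ofReal_le_ofReal ?_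
  have hterm : ∀ j ∈ Finset.range (N + 1), (θ j).toReal * Real.exp (j * y)
      ≤ (θ j).toReal + y * ((θ j).toReal * j) + (θ j).toReal * ((N + 1) ^ 2 * y ^ 2) := by
    intro j hj
    have hjN : (j : ℝ) ≤ N + 1 := by
      have : j ≤ N + 1 := (Finset.mem_range.1 hj).le
      exact_mod_cast this
    have hjy0 : 0 ≤ (j : ℝ) * y := by positivity
    have hjy1 : (j : ℝ) * y ≤ 1 := by nlinarith
    have h2 := Real.abs_exp_sub_one_sub_id_le (x := j * y) (by rwa [abs_of_nonneg hjy0])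
    have h3 := (abs_le.1 h2).2
    have h4 : ((j : ℝ) * y) ^ 2 ≤ (N + 1) ^ 2 * y ^ 2 := by
      rw [mul_pow]; gcongr
    have h5 : Real.exp (j * y) ≤ 1 + j * y + (N + 1) ^ 2 * y ^ 2 := by linarith
    calc (θ j).toReal * Real.exp (j * y)
        ≤ (θ j).toReal * (1 + j * y + (N + 1) ^ 2 * y ^ 2) :=
          mul_le_mul_of_nonneg_left h5 ENNReal.toReal_nonneg
      _ = _ := by ring
  calc ∑ j ∈ Finset.range (N + 1), (θ j).toReal * Real.exp (j * y)
      ≤ ∑ j ∈ Finset.range (N + 1),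
        ((θ j).toReal + y * ((θ j).toReal * j) + (θ j).toReal * ((N + 1) ^ 2 * y ^ 2)) :=
        Finset.sum_le_sum hterm
    _ = 1 + y * m + (N + 1) ^ 2 * y ^ 2 := by
        rw [Finset.sum_add_distrib, Finset.sum_add_distrib, ← Finset.mul_sum, ← Finset.sum_mul,
          sum_toReal_eq_one θ hθ, ← hm, one_mul]
    _ ≤ b * y + 1 := by nlinarith
    _ ≤ Real.exp (b * y) := Real.add_one_le_exp _

lemma ae_forall_le (θ : PMF ℕ) {N : ℕ} (hθ : ∀ j, N < j → θ j = 0) :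
    ∀ᵐ c ∂gwMeasure θ, ∀ v, c v ≤ N := by
  rw [ae_all_iff]
  intro v
  have hmp := measurePreserving_eval_infinitePi (fun _ : List ℕ => θ.toMeasure) v
  have h0 : ∀ᵐ j ∂θ.toMeasure, j ≤ N := by
    rw [ae_iff, PMF.toMeasure_apply_eq_zero_iff _ (MeasurableSet.of_discrete)]
    rw [Set.disjoint_left]
    intro j hj hj'
    exact (θ.mem_support_iff j).1 hj (hθ j (not_le.1 hj'))
  exact hmp.quasiMeasurePreserving.ae h0

/-- Almost surely the numbers of descendants of all nodes in all generations are bounded. -/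
lemma ae_exists_genCount_descTree_le (θ : PMF ℕ) {N : ℕ} (hθ : ∀ j, N < j → θ j = 0) {m b : ℝ}
    (hm : m = ∑ j ∈ Finset.range (N + 1), (θ j).toReal * j) (hb1 : 1 ≤ b) (hb : m < b) :
    ∀ᵐ c ∂gwMeasure θ, ∃ C : ℝ, 0 < C ∧ ∀ u : List ℕ, (∀ i ∈ u, i < N) → ∀ l : ℕ,
      (genCount l (descTree c u) : ℝ) ≤ C * (u.length + l + 1) * b ^ l := by
  obtain ⟨y₀, hy₀, hy⟩ := exists_generating_exp_le θ hθ hm hb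
  have hN : (0 : ℝ) < (N : ℝ) + 1 := by positivity
  -- With `t = D * (n + l + 1)` the tail becomes a multiple of `(2 * (N + 1)) ^ (-(n + l + 1))`,
  -- which beats the `N ^ n` words of length `n` and remains summable in `n` and `l`.
  set D : ℝ := Real.log (2 * (N + 1)) / y₀ with hD
  have hD0 : 0 < D := div_pos (Real.log_pos (by linarith [Nat.cast_nonneg (α := ℝ) N])) hy₀
  have hyD : y₀ * D = Real.log (2 * (N + 1)) := by rw [hD]; field_simp
  let B : ℕ × ℕ → Set (List ℕ → ℕ) := fun p => ⋃ w : Fin p.1 → Fin N,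
    {c | D * (p.1 + p.2 + 1 : ℝ) * b ^ p.2
      < genCount p.2 (descTree c (List.ofFn fun i => (w i : ℕ)))}
  have hB : ∀ p, gwMeasure θ (B p)
      ≤ ENNReal.ofReal (Real.exp y₀) * ((2⁻¹ : ℝ≥0∞) ^ p.1 * 2⁻¹ ^ p.2) := by
    rintro ⟨n, l⟩
    have h1 : ∀ w : Fin n → Fin N, gwMeasure θ {c | D * (n + l + 1 : ℝ) * b ^ l
        < genCount l (descTree c (List.ofFn fun i => (w i : ℕ)))}
        ≤ ENNReal.ofReal (Real.exp (y₀ - y₀ * (D * (n + l + 1)))) := by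
      intro w
      refine le_trans (le_of_eq ?_) (measure_lt_genCount_le θ hb1 hy₀ hy l _)
      have hmeas : MeasurableSet {c | D * (n + l + 1 : ℝ) * b ^ l < genCount l c} :=
        (measurable_genCount l) (MeasurableSet.of_discrete (s := {k : ℕ | D * (n + l + 1 : ℝ) * b ^ l < k}))
      exact (measurePreserving_descTree θ _).measure_preimage hmeas.nullMeasurableSet
    have h2 : Real.exp (y₀ - y₀ * (D * (n + l + 1)))
        = Real.exp y₀ * (1 / (2 * (N + 1))) ^ (n + l + 1) := by
      have : y₀ - y₀ * (D * (n + l + 1)) = y₀ + ((n + l + 1 : ℕ) : ℝ) * (-Real.log (2 * (N + 1))) := by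
        rw [← hyD]; push_cast; ring
      rw [this, Real.exp_add, Real.exp_nat_mul, Real.exp_neg, Real.exp_log (by positivity),
        one_div]
    have h3 : (N : ℝ) ^ n * (Real.exp y₀ * (1 / (2 * (N + 1))) ^ (n + l + 1))
        ≤ Real.exp y₀ * (2⁻¹ ^ n * 2⁻¹ ^ l) := by
      have e1 : (N : ℝ) ^ n * (1 / (2 * (N + 1))) ^ n ≤ 2⁻¹ ^ n := by
        rw [← mul_pow]
        gcongr
        rw [mul_one_div, div_le_iff₀ (by positivity)]
        linarith
      have e2 : (1 / (2 * ((N : ℝ) + 1))) ≤ 2⁻¹ := by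
        rw [inv_eq_one_div]
        gcongr
        linarith [Nat.cast_nonneg (α := ℝ) N]
      have e3 : (1 / (2 * ((N : ℝ) + 1))) ^ (l + 1) ≤ 2⁻¹ ^ l := by
        rw [pow_succ]
        calc _ ≤ (1 / (2 * ((N : ℝ) + 1))) ^ l * 1 := by
              gcongr
              linarith
          _ ≤ 2⁻¹ ^ l := by rw [mul_one]; gcongr
      calc _ = Real.exp y₀ * (((N : ℝ) ^ n * (1 / (2 * (N + 1))) ^ n)
            * (1 / (2 * ((N : ℝ) + 1))) ^ (l + 1)) := by ring
        _ ≤ _ := by gcongr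
    have h2' : (2⁻¹ : ℝ≥0∞) = ENNReal.ofReal 2⁻¹ := by
      rw [ENNReal.ofReal_inv_of_pos two_pos]; simp
    calc gwMeasure θ (B (n, l)) ≤ ∑ w : Fin n → Fin N, gwMeasure θ {c | D * (n + l + 1 : ℝ) * b ^ l
        < genCount l (descTree c (List.ofFn fun i => (w i : ℕ)))} := measure_iUnion_fintype_le _ _
      _ ≤ ∑ w : Fin n → Fin N, ENNReal.ofReal (Real.exp (y₀ - y₀ * (D * (n + l + 1)))) :=
          Finset.sum_le_sum fun w _ => h1 w
      _ = ENNReal.ofReal ((N : ℝ) ^ n * (Real.exp y₀ * (1 / (2 * (N + 1))) ^ (n + l + 1))) := by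
          rw [h2, ENNReal.ofReal_mul (p := (N : ℝ) ^ n) (by positivity),
            ENNReal.ofReal_pow (Nat.cast_nonneg N)]
          simp
      _ ≤ ENNReal.ofReal (Real.exp y₀ * (2⁻¹ ^ n * 2⁻¹ ^ l)) := ENNReal.ofReal_le_ofReal h3
      _ = _ := by
          rw [ENNReal.ofReal_mul (by positivity), ENNReal.ofReal_mul (by positivity),
            ENNReal.ofReal_pow (by positivity), ENNReal.ofReal_pow (by positivity), h2']
  have hsum : ∑' p, gwMeasure θ (B p) ≠ ∞ := by
    refine ne_top_of_le_ne_top ?_ (ENNReal.tsum_le_tsum hB)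
    rw [ENNReal.tsum_mul_left, ENNReal.tsum_prod (f := fun n l => (2⁻¹ : ℝ≥0∞) ^ n * 2⁻¹ ^ l)]
    simp_rw [ENNReal.tsum_mul_left, ENNReal.tsum_mul_right]
    rw [ENNReal.tsum_geometric, ENNReal.one_sub_inv_two, inv_inv]
    exact ENNReal.mul_ne_top ENNReal.ofReal_ne_top (by norm_num)
  filter_upwards [ae_finite_setOfPred_mem hsum, ae_forall_le θ hθ] with c hfin hc
  -- The finitely many exceptional pairs are absorbed by the trivial bound `N ^ l`.
  refine ⟨D + ∑ p ∈ hfin.toFinset, (N : ℝ) ^ p.2, by positivity, fun u hu l => ?_⟩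
  have hbl : 1 ≤ b ^ l := one_le_pow₀ hb1
  have hul : (1 : ℝ) ≤ u.length + l + 1 := by
    linarith [Nat.cast_nonneg (α := ℝ) u.length, Nat.cast_nonneg (α := ℝ) l]
  by_cases hcB : c ∈ B (u.length, l)
  · have h1 : (genCount l (descTree c u) : ℝ) ≤ (N : ℝ) ^ l := by
      exact_mod_cast genCount_le_pow (fun v => hc (u ++ v)) l
    have h2 : (N : ℝ) ^ l ≤ ∑ p ∈ hfin.toFinset, (N : ℝ) ^ p.2 :=
      Finset.single_le_sum (f := fun p : ℕ × ℕ => (N : ℝ) ^ p.2) (fun p _ => by positivity)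
        (hfin.mem_toFinset.2 hcB)
    have h3 : 0 ≤ D + ∑ p ∈ hfin.toFinset, (N : ℝ) ^ p.2 := by positivity
    calc (genCount l (descTree c u) : ℝ) ≤ (D + ∑ p ∈ hfin.toFinset, (N : ℝ) ^ p.2) * 1 * 1 := by
          linarith
      _ ≤ _ := by gcongr
  · have h1 : (genCount l (descTree c u) : ℝ) ≤ D * (u.length + l + 1) * b ^ l := by
      by_contra! hcon
      refine hcB (Set.mem_iUnion.2 ⟨fun i => ⟨u[i], hu _ (List.getElem_mem _)⟩, ?_⟩)
      simpa [List.ofFn_getElem] using hcon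
    refine h1.trans ?_
    gcongr
    exact le_add_of_nonneg_right (by positivity)

/-! ### Prefixes, infinite paths and cutsets -/

/-- The prefix of length `n` of the word `x`. -/
def pathPrefix (n : ℕ) (x : ℕ → ℕ) : List ℕ := List.ofFn fun i : Fin n => x i

@[simp] lemma length_pathPrefix (n : ℕ) (x : ℕ → ℕ) : (pathPrefix n x).length = n := by
  simp [pathPrefix]

@[simp] lemma pathPrefix_zero (x : ℕ → ℕ) : pathPrefix 0 x = [] := rfl

lemma pathPrefix_succ (n : ℕ) (x : ℕ → ℕ) :
    pathPrefix (n + 1) x = x 0 :: pathPrefix n fun k => x (k + 1) := by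
  simp [pathPrefix, List.ofFn_succ]

lemma getElem_pathPrefix {n i : ℕ} (x : ℕ → ℕ) (h : i < (pathPrefix n x).length) :
    (pathPrefix n x)[i] = x i := by
  simp [pathPrefix]

lemma pathPrefix_add (n l : ℕ) (x : ℕ → ℕ) :
    pathPrefix (n + l) x = pathPrefix n x ++ pathPrefix l fun k => x (n + k) := by
  refine List.ext_getElem (by simp) fun i h1 h2 => ?_
  rw [getElem_pathPrefix, List.getElem_append]
  split_ifs with h
  · rw [getElem_pathPrefix]
  · rw [getElem_pathPrefix]
    simp only [length_pathPrefix, not_lt] at h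
    simp [Nat.add_sub_cancel' h]

lemma pathPrefix_succ_last (n : ℕ) (x : ℕ → ℕ) :
    pathPrefix (n + 1) x = pathPrefix n x ++ [x n] := by
  rw [pathPrefix_add]
  simp [pathPrefix]

lemma take_pathPrefix {n i : ℕ} (h : i ≤ n) (x : ℕ → ℕ) :
    (pathPrefix n x).take i = pathPrefix i x := by
  obtain ⟨l, rfl⟩ := Nat.exists_eq_add_of_le h
  rw [pathPrefix_add, List.take_left' (length_pathPrefix i x)]

lemma pathPrefix_eq_iff {n : ℕ} {x y : ℕ → ℕ} :
    pathPrefix n x = pathPrefix n y ↔ ∀ i < n, x i = y i := by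
  simp only [pathPrefix, List.ofFn_inj, funext_iff]
  exact ⟨fun h i hi => h ⟨i, hi⟩, fun h i => h i i.2⟩

lemma mem_gromovBoundary {c : List ℕ → ℕ} {x : ℕ → ℕ} :
    x ∈ gromovBoundary c ↔ ∀ n, x n < c (pathPrefix n x) := by
  constructor
  · intro h n
    have h1 : pathPrefix (n + 1) x ∈ familyTree c := h (n + 1)
    have h2 := h1 n (by simp)
    rwa [getElem_pathPrefix, take_pathPrefix (Nat.le_succ n)] at h2
  · refine fun h n => (?_ : pathPrefix n x ∈ familyTree c)
    intro i hi
    have hi' : i < n := by simpa using hi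
    rw [getElem_pathPrefix, take_pathPrefix hi'.le]
    exact h i

lemma tail_mem_gromovBoundary {c : List ℕ → ℕ} {x : ℕ → ℕ} (hx : x ∈ gromovBoundary c) (n : ℕ) :
    (fun k => x (n + k)) ∈ gromovBoundary (descTree c (pathPrefix n x)) := by
  rw [mem_gromovBoundary] at hx ⊢
  intro k
  have := hx (n + k)
  rwa [pathPrefix_add] at this

lemma encard_image_pathPrefix_le (c : List ℕ → ℕ) (l : ℕ) :
    (pathPrefix l '' gromovBoundary c).encard ≤ genCount l c := by
  induction l generalizing c with
  | zero =>
    have : pathPrefix 0 '' gromovBoundary c ⊆ {[]} := by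
      rintro _ ⟨x, _, rfl⟩; rfl
    simpa [genCount] using Set.encard_le_encard this
  | succ l ih =>
    have hsub : pathPrefix (l + 1) '' gromovBoundary c ⊆ ⋃ i ∈ Finset.range (c []),
        (List.cons i) '' (pathPrefix l '' gromovBoundary (childTree c i)) := by
      rintro _ ⟨x, hx, rfl⟩
      have h0 := mem_gromovBoundary.1 hx 0
      have h1 := tail_mem_gromovBoundary hx 1
      refine Set.mem_iUnion₂.2 ⟨x 0, Finset.mem_range.2 h0, _, ⟨_, ?_, rfl⟩,
        (pathPrefix_succ l x).symm⟩
      simp only [Nat.add_comm 1] at h1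
      exact h1
    calc (pathPrefix (l + 1) '' gromovBoundary c).encard
        ≤ _ := Set.encard_le_encard hsub
      _ ≤ ∑ i ∈ Finset.range (c []),
          ((List.cons i) '' (pathPrefix l '' gromovBoundary (childTree c i))).encard :=
        Finset.set_encard_biUnion_le _ _
      _ ≤ ∑ i ∈ Finset.range (c []), (genCount l (childTree c i) : ℕ∞) :=
        Finset.sum_le_sum fun i _ => (Set.encard_image_le _ _).trans (ih _)
      _ = genCount (l + 1) c := by simp [genCount]

lemma encard_image_pathPrefix_cylinder_le (c : List ℕ → ℕ) (n l : ℕ) (x : ℕ → ℕ) :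
    (pathPrefix (n + l) '' (gromovBoundary c ∩ {y | pathPrefix n y = pathPrefix n x})).encard
      ≤ genCount l (descTree c (pathPrefix n x)) := by
  have hsub : pathPrefix (n + l) '' (gromovBoundary c ∩ {y | pathPrefix n y = pathPrefix n x})
      ⊆ (fun v => pathPrefix n x ++ v) ''
        (pathPrefix l '' gromovBoundary (descTree c (pathPrefix n x))) := by
    rintro _ ⟨y, ⟨hy, hyx⟩, rfl⟩
    refine ⟨_, ⟨fun k => y (n + k), ?_, rfl⟩, ?_⟩
    · have := tail_mem_gromovBoundary hy n
      rwa [show pathPrefix n y = pathPrefix n x from hyx] at this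
    · rw [pathPrefix_add, show pathPrefix n y = pathPrefix n x from hyx]
  exact (Set.encard_le_encard hsub).trans
    ((Set.encard_image_le _ _).trans (encard_image_pathPrefix_le _ _))

/-- The node at level `n` on the path with the successive choices `f`. -/
def greedyPath {S : List ℕ → Prop} (f : ∀ w, S w → {i : ℕ // S (w ++ [i])}) (h0 : S []) :
    ℕ → {w // S w}
  | 0 => ⟨[], h0⟩
  | n + 1 => ⟨_, (f _ (greedyPath f h0 n).2).2⟩

lemma exists_path {S : List ℕ → Prop} {R : List ℕ → ℕ → Prop} (h0 : S [])
    (h : ∀ w, S w → ∃ i, R w i ∧ S (w ++ [i])) :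
    ∃ x : ℕ → ℕ, ∀ n, S (pathPrefix n x) ∧ R (pathPrefix n x) (x n) := by
  choose f hR hS using h
  let g := greedyPath (fun w hw => ⟨f w hw, hS w hw⟩) h0
  let x : ℕ → ℕ := fun n => f (g n).1 (g n).2
  have hx : ∀ n, pathPrefix n x = (g n).1 := by
    intro n
    induction n with
    | zero => rfl
    | succ n ih => rw [pathPrefix_succ_last, ih]; rfl
  refine ⟨x, fun n => ?_⟩
  rw [hx]
  exact ⟨(g n).2, hR _ _⟩

/-- A family of nodes that meets all infinite paths has total weight at least `minContent a c`. -/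
lemma minContent_le_tsum {ι : Type*} {a : ℝ≥0∞} (ha : a ≠ ∞) (c : List ℕ → ℕ) (U : ι → List ℕ)
    (hU : ∀ x ∈ gromovBoundary c, ∃ j, pathPrefix (U j).length x = U j) :
    minContent a c ≤ ∑' j, a ^ (U j).length := by
  classical
  by_contra! hlt
  -- `W w` is the cost of the part of the family below `w`, normalised at `w`. `S` collects the
  -- nodes where this is cheaper than the content. Such a node is not in the family and has a child
  -- in `S`, so the root in `S` starts an infinite path that avoids the family. No finiteness of the
  -- family is needed.
  let W : List ℕ → ℝ≥0∞ := fun w => ∑' j, if w <+: U j then a ^ ((U j).length - w.length) else 0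
  let S : List ℕ → Prop := fun w => W w < minContent a (descTree c w)
  have hnot : ∀ w, S w → ∀ j, U j ≠ w := by
    rintro w hw j rfl
    have h1 : (1 : ℝ≥0∞) ≤ W (U j) := by
      refine le_trans ?_ (ENNReal.le_tsum j)
      simp
    exact absurd (h1.trans_lt hw) (not_lt.2 (minContent_le_one _ _))
  have h0 : S [] := by
    change W [] < minContent a (fun v => c v)
    simpa [W] using hlt
  have hstep : ∀ w, S w → ∃ i, i < c w ∧ S (w ++ [i]) := by
    intro w hw
    by_contra! hcon
    refine absurd hw (not_lt.2 ?_)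
    have hroot : descTree c w [] = c w := by simp [descTree]
    have hchild : ∀ i, childTree (descTree c w) i = descTree c (w ++ [i]) := fun i => by
      ext v; simp [childTree, descTree]
    calc minContent a (descTree c w)
        ≤ a * ∑ i ∈ Finset.range (c w), minContent a (descTree c (w ++ [i])) := by
          rw [minContent_eq ha, hroot]
          simp_rw [hchild]
          exact min_le_right _ _
      _ ≤ a * ∑ i ∈ Finset.range (c w), W (w ++ [i]) := by
          gcongr with i hi
          exact not_lt.1 (hcon i (Finset.mem_range.1 hi))
      _ = ∑' j, a * ∑ i ∈ Finset.range (c w),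
            if (w ++ [i]) <+: U j then a ^ ((U j).length - (w ++ [i]).length) else 0 := by
          rw [ENNReal.tsum_mul_left, Summable.tsum_finsetSum fun _ _ => ENNReal.summable]
      _ ≤ W w := by
          refine ENNReal.tsum_le_tsum fun j => ?_
          -- Each `U j` lies below at most one child of `w`, so the children share the cost without
          -- double counting.
          by_cases hex : ∃ i₀, (w ++ [i₀]) <+: U j
          · obtain ⟨i₀, hi₀⟩ := hex
            have hw' : w <+: U j := (List.prefix_append w [i₀]).trans hi₀
            rw [if_pos hw']
            have hlen : w.length + 1 ≤ (U j).length := by simpa using hi₀.length_le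
            have huniq : ∀ i, (w ++ [i]) <+: U j → i = i₀ := by
              intro i hi
              have h1 := (List.prefix_iff_eq_take.1 hi).trans
                ((by simp : (U j).take (w ++ [i]).length = (U j).take (w ++ [i₀]).length).trans
                  (List.prefix_iff_eq_take.1 hi₀).symm)
              simpa using h1
            calc a * ∑ i ∈ Finset.range (c w),
                  (if (w ++ [i]) <+: U j then a ^ ((U j).length - (w ++ [i]).length) else 0)
                ≤ a * ∑ i ∈ Finset.range (c w),
                  (if i = i₀ then a ^ ((U j).length - (w.length + 1)) else 0) := by
                  gcongr with i _
                  split_ifs with h1 h2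
                  · simp
                  · exact absurd (huniq i h1) h2
                  · exact zero_le
                  · exact le_rfl
              _ ≤ a * a ^ ((U j).length - (w.length + 1)) := by
                  gcongr
                  rw [Finset.sum_ite_eq']
                  split_ifs
                  · exact le_rfl
                  · exact zero_le
              _ = a ^ ((U j).length - w.length) := by
                  rw [← pow_succ']
                  congr 1
                  omega
          · push Not at hex
            rw [Finset.sum_eq_zero fun i _ => if_neg (hex i), mul_zero]
            exact zero_le
  obtain ⟨x, hx⟩ := exists_path (R := fun w i => i < c w) h0 hstep
  obtain ⟨j, hj⟩ := hU x (mem_gromovBoundary.2 fun n => (hx n).2)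
  exact hnot _ (hx (U j).length).1 j hj.symm

/-- The prefixes of length `k` of boundary points form a cutset. -/
lemma minContent_le_encard_mul {a : ℝ≥0∞} (ha : a ≠ ∞) (c : List ℕ → ℕ) (k : ℕ) :
    minContent a c ≤ ((pathPrefix k '' gromovBoundary c).encard : ℝ≥0∞) * a ^ k := by
  have h := minContent_le_tsum ha c
    (fun w : (pathPrefix k '' gromovBoundary c) => (w : List ℕ)) (fun x hx =>
      ⟨⟨_, x, hx, rfl⟩, by simp⟩)
  refine h.trans_eq ?_
  have h1 : ∀ w : (pathPrefix k '' gromovBoundary c), a ^ (w : List ℕ).length = a ^ k := by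
    rintro ⟨_, x, _, rfl⟩; simp
  simp_rw [h1]
  rw [ENNReal.tsum_const]
  rfl

/-- At weight `1` a single line of descent keeps every minimum at `1`. This is how survival is
expressed through the content. -/
lemma cutContent_one_eq_one {c : List ℕ → ℕ} {u : List ℕ} (hu : u ∈ familyTree c) :
    cutContent 1 u.length c = 1 := by
  induction u generalizing c with
  | nil => rfl
  | cons i u ih =>
    have h0 : i < c [] := hu 0 (by simp)
    have h1 : u ∈ familyTree (childTree c i) := fun k hk =>
      hu (k + 1) (by simpa using hk)
    refine le_antisymm (cutContent_le_one _ _ _) (le_min le_rfl ?_)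
    rw [one_mul]
    exact (ih h1).ge.trans (Finset.single_le_sum
      (f := fun k => cutContent 1 u.length (childTree c k)) (fun _ _ => zero_le)
      (Finset.mem_range.2 h0))

lemma minContent_one_ne_zero {c : List ℕ → ℕ} (h : ∀ k, 0 < generationSize c k) :
    minContent 1 c ≠ 0 := by
  have : minContent 1 c = 1 := by
    refine le_antisymm (minContent_le_one _ _) (le_iInf fun k => ?_)
    obtain ⟨u, hu, rfl⟩ := Set.encard_pos.1 (h k)
    exact (cutContent_one_eq_one hu).ge
  simp [this]

/-! ### Dyadic scales and covering numbers -/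

lemma dist_le_iff_pathPrefix_eq {r : ℝ} {k : ℕ} (h1 : (1 / 2) ^ k ≤ r) (h2 : r < 2 * (1 / 2) ^ k)
    (y x : ℕ → ℕ) : dist y x ≤ r ↔ pathPrefix k y = pathPrefix k x := by
  have hcyl : dist y x ≤ (1 / 2) ^ k ↔ pathPrefix k y = pathPrefix k x := by
    rw [pathPrefix_eq_iff, ← PiNat.mem_cylinder_iff]
    exact PiNat.mem_cylinder_iff_dist_le.symm
  refine ⟨fun h => ?_, fun h => (hcyl.2 h).trans h1⟩
  rcases eq_or_ne y x with rfl | hne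
  · rfl
  · rw [← hcyl]
    have hd : dist y x = (1 / 2 : ℝ) ^ PiNat.firstDiff y x := PiNat.dist_eq_of_ne hne
    rw [hd] at h ⊢
    have hlt : (1 / 2 : ℝ) ^ (PiNat.firstDiff y x + 1) < (1 / 2) ^ k := by
      rw [pow_succ]; linarith
    have := (pow_lt_pow_iff_right_of_lt_one₀ (by norm_num : (0 : ℝ) < 1 / 2) (by norm_num)).1 hlt
    exact pow_le_pow_of_le_one (by norm_num) (by norm_num) (by omega)

lemma exists_level {r : ℝ} (h0 : 0 < r) (h1 : r < 1) :
    ∃ k : ℕ, 1 ≤ k ∧ (1 / 2) ^ k ≤ r ∧ r < 2 * (1 / 2) ^ k := by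
  classical
  have hex : ∃ k : ℕ, (1 / 2 : ℝ) ^ k ≤ r := by
    obtain ⟨k, hk⟩ := exists_pow_lt_of_lt_one h0 (by norm_num : (1 / 2 : ℝ) < 1)
    exact ⟨k, hk.le⟩
  have hspec := Nat.find_spec hex
  have hne : Nat.find hex ≠ 0 := fun h => by
    rw [h, pow_zero] at hspec; linarith
  obtain ⟨j, hj⟩ := Nat.exists_eq_succ_of_ne_zero hne
  have hlt := not_le.1 (Nat.find_min hex (show j < Nat.find hex by omega))
  refine ⟨Nat.find hex, by omega, hspec, ?_⟩
  rw [hj, Nat.succ_eq_add_one, pow_succ]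
  linarith

lemma coverCount_eq_encard {r : ℝ} {k : ℕ} (h1 : (1 / 2) ^ k ≤ r) (h2 : r < 2 * (1 / 2) ^ k)
    (A : Set (ℕ → ℕ)) : coverCount r A = ((pathPrefix k '' A).encard : ℝ≥0∞) := by
  have hr : 0 ≤ r := le_trans (by positivity) h1
  have hiff : ∀ C : Set (ℕ → ℕ), Metric.IsCover r.toNNReal A C
      ↔ ∀ x ∈ A, ∃ y ∈ C, pathPrefix k x = pathPrefix k y := by
    intro C
    rw [Metric.isCover_iff_subset_iUnion_closedBall]
    simp only [Set.subset_def, Set.mem_iUnion, Metric.mem_closedBall, Real.coe_toNNReal r hr,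
      dist_le_iff_pathPrefix_eq h1 h2, exists_prop]
  unfold coverCount
  congr 1
  refine le_antisymm ?_ (le_iInf₂ fun C hC => ?_)
  · let e : List ℕ → ℕ → ℕ := fun w i => w.getD i 0
    have he : ∀ x, pathPrefix k (e (pathPrefix k x)) = pathPrefix k x := by
      intro x
      rw [pathPrefix_eq_iff]
      intro i hi
      simp [e, pathPrefix, hi]
    refine (Metric.IsCover.externalCoveringNumber_le_encard (C := e '' (pathPrefix k '' A))
      ((hiff _).2 fun x hx => ?_)).trans (Set.encard_image_le _ _)
    exact ⟨_, ⟨_, ⟨x, hx, rfl⟩, rfl⟩, (he x).symm⟩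
  · refine (Set.encard_le_encard ?_).trans (Set.encard_image_le (pathPrefix k) C)
    rintro _ ⟨x, hx, rfl⟩
    obtain ⟨y, hy, hxy⟩ := (hiff C).1 hC x hx
    exact ⟨y, hy, hxy.symm⟩

lemma closedBall_eq_cylinder {R : ℝ} {n : ℕ} (h1 : (1 / 2) ^ n ≤ R) (h2 : R < 2 * (1 / 2) ^ n)
    (x : ℕ → ℕ) : Metric.closedBall x R = {y | pathPrefix n y = pathPrefix n x} := by
  ext y
  exact dist_le_iff_pathPrefix_eq h1 h2 y x

lemma level_le_level {r R : ℝ} {k n : ℕ} (hrR : r ≤ R) (h1 : (1 / 2) ^ k ≤ r)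
    (h2 : R < 2 * (1 / 2) ^ n) : n ≤ k := by
  have hlt : (1 / 2 : ℝ) ^ (k + 1) < (1 / 2) ^ n := by
    rw [pow_succ]; linarith
  have := (pow_lt_pow_iff_right_of_lt_one₀ (by norm_num : (0 : ℝ) < 1 / 2) (by norm_num)).1 hlt
  omega

/-- Balls of radius `R` are cylinders, so those meeting `F` can be recentred in `F` without changing
the radius. This makes covers compose with no loss of constants. -/
lemma coverCount_le_mul {F : Set (ℕ → ℕ)} {r R : ℝ} (hr : 0 < r) (hrR : r < R) (hR : R < 1)
    (hfin : coverCount R F ≠ ∞) {B : ℝ≥0∞}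
    (hB : ∀ x ∈ F, coverCount r (F ∩ Metric.closedBall x R) ≤ B) :
    coverCount r F ≤ coverCount R F * B := by
  obtain ⟨k, -, hk1, hk2⟩ := exists_level hr (hrR.trans hR)
  obtain ⟨n, -, hn1, hn2⟩ := exists_level (hr.trans hrR) hR
  rw [coverCount_eq_encard hn1 hn2] at hfin ⊢
  rw [coverCount_eq_encard hk1 hk2]
  simp_rw [coverCount_eq_encard hk1 hk2, closedBall_eq_cylinder hn1 hn2] at hB
  have hfinite : (pathPrefix n '' F).Finite := by
    rw [← Set.encard_lt_top_iff, ← ENat.toENNReal_lt_top]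
    exact lt_top_iff_ne_top.2 hfin
  have hsub : pathPrefix k '' F ⊆ ⋃ w ∈ hfinite.toFinset,
      pathPrefix k '' (F ∩ {y | pathPrefix n y = w}) := by
    rintro _ ⟨x, hx, rfl⟩
    exact Set.mem_iUnion₂.2 ⟨pathPrefix n x, hfinite.mem_toFinset.2 ⟨x, hx, rfl⟩, x, ⟨hx, rfl⟩, rfl⟩
  have h1 : (pathPrefix k '' F).encard ≤ ∑ w ∈ hfinite.toFinset,
      (pathPrefix k '' (F ∩ {y | pathPrefix n y = w})).encard :=
    (Set.encard_le_encard hsub).trans (Finset.set_encard_biUnion_le _ _)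
  have h2 : (((pathPrefix k '' F).encard : ℕ∞) : ℝ≥0∞) ≤ ∑ w ∈ hfinite.toFinset,
      (((pathPrefix k '' (F ∩ {y | pathPrefix n y = w})).encard : ℕ∞) : ℝ≥0∞) := by
    refine (ENat.toENNReal_le.2 h1).trans_eq ?_
    exact map_sum ENat.toENNRealRingHom _ _
  refine h2.trans ?_
  calc _ ≤ ∑ w ∈ hfinite.toFinset, B := by
        refine Finset.sum_le_sum fun w hw => ?_
        obtain ⟨x, hx, rfl⟩ := hfinite.mem_toFinset.1 hw
        exact hB x hx
    _ = _ := by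
        rw [Finset.sum_const, nsmul_eq_mul, hfinite.encard_eq_coe_toFinset_card]
        simp

/-! ### Hausdorff and box dimensions from covering bounds -/

/-- The Hausdorff dimension is at least `s` when all countable covers have a total `s`-size bounded
below. -/
lemma le_dimH_of_cover {X : Type*} [EMetricSpace X] {F : Set X} {s : ℝ≥0} {K : ℝ≥0∞}
    (hK : K ≠ 0) (h : ∀ t : ℕ → Set X, F ⊆ ⋃ n, t n → (∀ n, Metric.ediam (t n) ≤ 2⁻¹) →
      K ≤ ∑' n, ⨆ _ : (t n).Nonempty, Metric.ediam (t n) ^ (s : ℝ)) : (s : ℝ≥0∞) ≤ dimH F := by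
  borelize X
  refine le_dimH_of_hausdorffMeasure_ne_zero fun h0 => hK (le_antisymm ?_ bot_le)
  rw [← h0, Measure.hausdorffMeasure_apply]
  refine le_iSup₂_of_le 2⁻¹ (by simp) ?_
  exact le_iInf fun t => le_iInf fun ht => le_iInf fun hd => h t ht hd

/-- A mass distribution argument with the cutset content in place of a measure: each set of a cover
sits in a cylinder whose weight is at most the diameter to the power `s`, up to a summable error, so
the content bounds the `s`-size of the cover. -/
lemma le_dimH_gromovBoundary {c : List ℕ → ℕ} {a : ℝ} {s : ℝ≥0} (hs : 0 < s)
    (ha : a = (1 / 2 : ℝ) ^ (s : ℝ)) (hc : minContent (ENNReal.ofReal a) c ≠ 0) :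
    (s : ℝ≥0∞) ≤ dimH (gromovBoundary c) := by
  have ha0 : 0 < a := by rw [ha]; positivity
  have ha1 : a < 1 := by
    rw [ha]; exact Real.rpow_lt_one (by norm_num) (by norm_num) (by exact_mod_cast hs)
  refine le_dimH_of_cover hc fun t ht hd => ?_
  refine ENNReal.le_of_forall_pos_le_add fun ε hε _ => ?_
  obtain ⟨δ, hδ0, hδ⟩ := ENNReal.exists_pos_sum_of_countable (ε := ε)
    (by exact_mod_cast hε.ne') ℕ
  have hex : ∀ j, ∃ w : List ℕ, (∀ x ∈ t j, pathPrefix w.length x = w) ∧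
      ENNReal.ofReal a ^ w.length
        ≤ (⨆ _ : (t j).Nonempty, Metric.ediam (t j) ^ (s : ℝ)) + δ j := by
    intro j
    -- Empty sets and sets of diameter `0` determine no level; they receive a node so deep that its
    -- weight fits into the error `δ j`.
    obtain ⟨n, hn⟩ : ∃ n : ℕ, ENNReal.ofReal a ^ n ≤ δ j := by
      have h1 := ENNReal.tendsto_pow_atTop_nhds_zero_of_lt_one
        (show ENNReal.ofReal a < 1 by simpa using ha1)
      exact ((h1.eventually (gt_mem_nhds (show (0 : ℝ≥0∞) < δ j by exact_mod_cast hδ0 j))).exists).imp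
        fun n hn => le_of_lt hn
    rcases Set.eq_empty_or_nonempty (t j) with he | ⟨x, hx⟩
    · refine ⟨List.replicate n 0, by simp [he], ?_⟩
      rw [List.length_replicate]
      exact hn.trans le_add_self
    · have hdtop : Metric.ediam (t j) ≠ ∞ := ne_top_of_le_ne_top (by simp) (hd j)
      have hdist : ∀ y ∈ t j, dist y x ≤ (Metric.ediam (t j)).toReal := by
        intro y hy
        rw [dist_edist]
        exact ENNReal.toReal_mono hdtop (Metric.edist_le_ediam_of_mem hy hx)
      rcases eq_or_ne (Metric.ediam (t j)) 0 with h0 | h0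
      · refine ⟨pathPrefix n x, fun y hy => ?_, ?_⟩
        · have := hdist y hy
          rw [h0, ENNReal.toReal_zero] at this
          rw [length_pathPrefix, dist_le_zero.1 this]
        · rw [length_pathPrefix]
          exact hn.trans le_add_self
      · have hd0 : 0 < (Metric.ediam (t j)).toReal := ENNReal.toReal_pos h0 hdtop
        have hd1 : (Metric.ediam (t j)).toReal < 1 := by
          have := ENNReal.toReal_mono (by simp) (hd j)
          rw [ENNReal.toReal_inv] at this
          norm_num at this
          linarith
        obtain ⟨k, -, hk1, hk2⟩ := exists_level hd0 hd1
        refine ⟨pathPrefix k x, fun y hy => ?_, ?_⟩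
        · rw [length_pathPrefix]
          exact (dist_le_iff_pathPrefix_eq hk1 hk2 y x).1 (hdist y hy)
        · rw [length_pathPrefix, iSup_pos ⟨x, hx⟩]
          refine le_trans ?_ le_self_add
          rw [← ENNReal.ofReal_toReal hdtop, ENNReal.ofReal_rpow_of_pos hd0,
            ← ENNReal.ofReal_pow ha0.le]
          refine ENNReal.ofReal_le_ofReal ?_
          rw [ha, ← Real.rpow_natCast, ← Real.rpow_mul (by norm_num), mul_comm,
            Real.rpow_mul (by norm_num), Real.rpow_natCast]
          exact Real.rpow_le_rpow (by positivity) hk1 s.2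
  choose U hU1 hU2 using hex
  refine (minContent_le_tsum ENNReal.ofReal_ne_top c U fun x hx => ?_).trans ?_
  · obtain ⟨j, hj⟩ := Set.mem_iUnion.1 (ht hx)
    exact ⟨j, hU1 j x hj⟩
  · refine (ENNReal.tsum_le_tsum hU2).trans ?_
    rw [ENNReal.tsum_add]
    gcongr

section BoxDimension

lemma eventually_le_neg_log (B : ℝ) : ∀ᶠ r : ℝ in 𝓝[>] 0, 0 < r ∧ r < 1 ∧ B ≤ -Real.log r := by
  have h1 : ∀ᶠ r : ℝ in 𝓝[>] 0, 0 < r := self_mem_nhdsWithin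
  have h2 : ∀ᶠ r : ℝ in 𝓝[>] 0, r < 1 := nhdsWithin_le_nhds (gt_mem_nhds one_pos)
  have h3 := (tendsto_neg_atBot_atTop.comp Real.tendsto_log_nhdsGT_zero).eventually_ge_atTop B
  filter_upwards [h1, h2, h3] with r a b c using ⟨a, b, c⟩

variable {E : Type*} [PseudoMetricSpace E] {F : Set E}

lemma upperBoxDim_le {C t s : ℝ} (hC : 0 < C)
    (h : ∀ r, 0 < r → r < 1 → coverCount r F ≤ ENNReal.ofReal (C * r ^ (-t))) (hts : t < s) :
    upperBoxDim F ≤ s := by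
  refine limsup_le_of_le (by isBoundedDefault) ?_
  filter_upwards [eventually_le_neg_log (max 1 (Real.log C / (s - t)))] with r hr
  obtain ⟨h0, h1, hB⟩ := hr
  have hy : 0 < -Real.log r := lt_of_lt_of_le one_pos ((le_max_left _ _).trans hB)
  have hB2 : Real.log C ≤ (s - t) * -Real.log r := by
    rw [mul_comm, ← div_le_iff₀ (by linarith)]
    exact (le_max_right _ _).trans hB
  have hle : ENNReal.log (coverCount r F) ≤ ((s * -Real.log r : ℝ) : EReal) := by
    refine (ENNReal.log_monotone (h r h0 h1)).trans ?_
    have hpos : 0 < C * r ^ (-t) := by positivity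
    rw [ENNReal.log_ofReal, if_neg (not_le.2 hpos), Real.log_mul hC.ne' (by positivity),
      Real.log_rpow h0]
    exact EReal.coe_le_coe_iff.2 (by linarith)
  calc ENNReal.log (coverCount r F) / ((-Real.log r : ℝ) : EReal)
      ≤ ((s * -Real.log r : ℝ) : EReal) / ((-Real.log r : ℝ) : EReal) :=
        EReal.div_le_div_right_of_nonneg (by exact_mod_cast hy.le) hle
    _ = s := by rw [← EReal.coe_div, mul_div_cancel_right₀ _ hy.ne']

lemma le_lowerBoxDim {K t s : ℝ} (hK : 0 < K)
    (h : ∀ r, 0 < r → r < 1 → ENNReal.ofReal (K * r ^ (-t)) ≤ coverCount r F) (hts : s < t) :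
    s ≤ lowerBoxDim F := by
  refine le_liminf_of_le (by isBoundedDefault) ?_
  filter_upwards [eventually_le_neg_log (max 1 (-Real.log K / (t - s)))] with r hr
  obtain ⟨h0, h1, hB⟩ := hr
  have hy : 0 < -Real.log r := lt_of_lt_of_le one_pos ((le_max_left _ _).trans hB)
  have hB2 : -Real.log K ≤ (t - s) * -Real.log r := by
    rw [mul_comm, ← div_le_iff₀ (by linarith)]
    exact (le_max_right _ _).trans hB
  have hle : ((s * -Real.log r : ℝ) : EReal) ≤ ENNReal.log (coverCount r F) := by
    refine le_trans ?_ (ENNReal.log_monotone (h r h0 h1))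
    have hpos : 0 < K * r ^ (-t) := by positivity
    rw [ENNReal.log_ofReal, if_neg (not_le.2 hpos), Real.log_mul hK.ne' (by positivity),
      Real.log_rpow h0]
    exact EReal.coe_le_coe_iff.2 (by linarith)
  calc (s : EReal) = ((s * -Real.log r : ℝ) : EReal) / ((-Real.log r : ℝ) : EReal) := by
        rw [← EReal.coe_div, mul_div_cancel_right₀ _ hy.ne']
    _ ≤ _ := EReal.div_le_div_right_of_nonneg (by exact_mod_cast hy.le) hle

lemma lowerBoxDim_le_upperBoxDim : lowerBoxDim F ≤ upperBoxDim F :=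
  liminf_le_limsup (by isBoundedDefault) (by isBoundedDefault)

end BoxDimension

/-- Optimal covers at the scales `(1 / 2) ^ (n + 1)` have bounded `s`-sums. Finiteness of the
measure is enough, so `t = s` is allowed. -/
lemma dimH_le_of_coverCount_le {X : Type*} [MetricSpace X] {F : Set X} {C t : ℝ} {s : ℝ≥0}
    (hC : 0 < C) (h : ∀ r, 0 < r → r < 1 → coverCount r F ≤ ENNReal.ofReal (C * r ^ (-t)))
    (hts : t ≤ s) : dimH F ≤ s := by
  borelize X
  let r : ℕ → ℝ := fun n => (1 / 2) ^ (n + 1)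
  have hr0 : ∀ n, 0 < r n := fun n => by positivity
  have hr1 : ∀ n, r n < 1 := fun n => pow_lt_one₀ (by norm_num) (by norm_num) (by omega)
  have hex : ∀ n, ∃ D : Set X, Metric.IsCover (r n).toNNReal F D ∧
      (D.encard : ℝ≥0∞) = coverCount (r n) F := by
    intro n
    have : Nonempty {D : Set X // Metric.IsCover (r n).toNNReal F D} := ⟨⟨F, Metric.IsCover.rfl⟩⟩
    obtain ⟨⟨D, hD⟩, hD'⟩ := ENat.exists_eq_iInf
      fun D : {D : Set X // Metric.IsCover (r n).toNNReal F D} => (D : Set X).encard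
    exact ⟨D, hD, by rw [coverCount, Metric.externalCoveringNumber, iInf_subtype', ← hD']⟩
  choose D hD hDc using hex
  have hDcount : ∀ n, Countable (D n) := by
    intro n
    have hlt : (D n).encard < ⊤ := by
      rw [← ENat.toENNReal_lt_top, hDc]
      exact (h _ (hr0 n) (hr1 n)).trans_lt ENNReal.ofReal_lt_top
    exact (Set.encard_lt_top_iff.1 hlt).countable.to_subtype
  have hdiam : ∀ n (y : D n), Metric.ediam (Metric.closedBall (y : X) (r n))
      ≤ ENNReal.ofReal (2 * r n) := by
    intro n y
    refine Metric.ediam_le fun a ha b hb => ?_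
    rw [edist_dist]
    refine ENNReal.ofReal_le_ofReal ?_
    have h1 := dist_triangle_right a b (y : X)
    rw [Metric.mem_closedBall] at ha hb
    linarith
  have hrt : Tendsto (fun n => ENNReal.ofReal (2 * r n)) atTop (𝓝 0) := by
    have h1 : Tendsto (fun n => 2 * r n) atTop (𝓝 (2 * 0)) :=
      ((tendsto_pow_atTop_nhds_zero_of_lt_one (by norm_num : (0 : ℝ) ≤ 1 / 2)
        (by norm_num)).comp (tendsto_add_atTop_nat 1)).const_mul 2
    simpa using ENNReal.tendsto_ofReal h1
  have hcov : ∀ n, F ⊆ ⋃ y : D n, Metric.closedBall (y : X) (r n) := by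
    intro n
    have h1 := Metric.isCover_iff_subset_iUnion_closedBall.1 (hD n)
    rw [Real.coe_toNNReal _ (hr0 n).le] at h1
    rwa [Set.iUnion_coe_set]
  have hle := Measure.hausdorffMeasure_le_liminf_tsum (s : ℝ) F _ hrt
    (fun n (y : D n) => Metric.closedBall (y : X) (r n)) (Eventually.of_forall hdiam)
    (Eventually.of_forall hcov)
  refine dimH_le_of_hausdorffMeasure_ne_top (ne_top_of_le_ne_top
    (ENNReal.ofReal_ne_top (r := C * 2 ^ (s : ℝ))) (hle.trans ?_))
  refine liminf_le_of_frequently_le' (Frequently.of_forall fun n => ?_)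
  calc ∑' y : D n, Metric.ediam (Metric.closedBall (y : X) (r n)) ^ (s : ℝ)
      ≤ ∑' _ : D n, ENNReal.ofReal (2 * r n) ^ (s : ℝ) :=
        ENNReal.tsum_le_tsum fun y => ENNReal.rpow_le_rpow (hdiam n y) s.2
    _ = coverCount (r n) F * ENNReal.ofReal (2 * r n) ^ (s : ℝ) := by
        rw [ENNReal.tsum_const, ← hDc]; rfl
    _ ≤ ENNReal.ofReal (C * r n ^ (-t)) * ENNReal.ofReal ((2 * r n) ^ (s : ℝ)) := by
        rw [ENNReal.ofReal_rpow_of_nonneg (by linarith [hr0 n]) (NNReal.coe_nonneg s)]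
        gcongr
        exact h _ (hr0 n) (hr1 n)
    _ ≤ ENNReal.ofReal (C * 2 ^ (s : ℝ)) := by
        rw [← ENNReal.ofReal_mul (by have := hr0 n; positivity)]
        refine ENNReal.ofReal_le_ofReal ?_
        have h1 : r n ^ (-t) * r n ^ (s : ℝ) ≤ 1 := by
          rw [← Real.rpow_add (hr0 n)]
          exact Real.rpow_le_one (hr0 n).le (hr1 n).le (by linarith)
        rw [Real.mul_rpow zero_le_two (hr0 n).le]
        calc C * r n ^ (-t) * (2 ^ (s : ℝ) * r n ^ (s : ℝ))
            = C * 2 ^ (s : ℝ) * (r n ^ (-t) * r n ^ (s : ℝ)) := by ring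
          _ ≤ C * 2 ^ (s : ℝ) * 1 := by gcongr
          _ = _ := mul_one _

/-! ### The growth condition on the dimension function -/

lemma exists_dimensionFunction_bound {φ : ℝ → ℝ} (hφ : IsDimensionFunction φ)
    (hω : (fun x : ℝ => Real.log |Real.log x| / |Real.log x|) =o[𝓝[>] 0] φ) {M : ℝ} (hM : 0 < M) :
    ∃ δ : ℝ, 0 < δ ∧ δ < 1 ∧ ∀ R, 0 < R → R < δ →
      1 ≤ Real.log |Real.log R| ∧ M * Real.log |Real.log R| ≤ φ R * |Real.log R| := by
  obtain ⟨δ₁, hδ₁, hpos, -, -⟩ := hφ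
  have h1 : ∀ᶠ x : ℝ in 𝓝[>] 0, x < δ₁ := nhdsWithin_le_nhds (gt_mem_nhds hδ₁)
  have h2 := hω.def (inv_pos.2 hM)
  have h3 := eventually_le_neg_log (Real.exp 1)
  have h4 : ∀ᶠ R : ℝ in 𝓝[>] 0, 1 ≤ Real.log |Real.log R| ∧
      M * Real.log |Real.log R| ≤ φ R * |Real.log R| := by
    filter_upwards [h1, h2, h3] with R hR1 hR2 hR3
    obtain ⟨hR0, -, hlog⟩ := hR3
    have habs : Real.exp 1 ≤ |Real.log R| := hlog.trans (neg_le_abs _)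
    have habs0 : 0 < |Real.log R| := (Real.exp_pos 1).trans_le habs
    have hll : 1 ≤ Real.log |Real.log R| := (Real.le_log_iff_exp_le habs0).2 habs
    refine ⟨hll, ?_⟩
    rw [Real.norm_of_nonneg (by positivity), Real.norm_of_nonneg (hpos R ⟨hR0, hR1⟩).le,
      div_le_iff₀ habs0] at hR2
    calc M * Real.log |Real.log R| ≤ M * (M⁻¹ * φ R * |Real.log R|) := by gcongr
      _ = φ R * |Real.log R| := by field_simp
  obtain ⟨δ, hδ, hsub⟩ := mem_nhdsGT_iff_exists_Ioo_subset.1 h4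
  have hδ0 : 0 < δ := hδ
  refine ⟨min δ (1 / 2), lt_min hδ0 (by norm_num), (min_le_right _ _).trans_lt (by norm_num),
    fun R hR0 hR => hsub ⟨hR0, hR.trans_le (min_le_left _ _)⟩⟩

lemma log_div_of_eq_rpow {R r f : ℝ} (hR : 0 < R) (hR1 : R < 1) (hr : r = R ^ (1 + f)) :
    Real.log (R / r) = f * |Real.log R| := by
  have hr0 : 0 < r := hr ▸ Real.rpow_pos_of_pos hR _
  rw [Real.log_div hR.ne' hr0.ne', hr, Real.log_rpow hR,
    abs_of_nonpos (Real.log_nonpos hR.le hR1.le)]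
  ring

/-- Since `log (R / r) = φ R * |log R|` dominates `log |log R|`, the depth of a ball of radius `R`
is subpolynomial in `R / r`. For `R` away from `0` the depth is bounded. -/
lemma exists_abs_log_le {φ : ℝ → ℝ} (hφ : IsDimensionFunction φ)
    (hω : (fun x : ℝ => Real.log |Real.log x| / |Real.log x|) =o[𝓝[>] 0] φ) {ε : ℝ} (hε : 0 < ε) :
    ∃ A : ℝ, 0 < A ∧ ∀ R r : ℝ, 0 < r → r = R ^ (1 + φ R) → r < R → R < 1 →
      |Real.log R| ≤ A * (R / r) ^ ε := by
  obtain ⟨δ, hδ0, hδ1, hδ⟩ := exists_dimensionFunction_bound hφ hω (inv_pos.2 hε)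
  refine ⟨1 + |Real.log δ|, by positivity, fun R r hr0 hr hrR hR1 => ?_⟩
  have hR0 : 0 < R := hr0.trans hrR
  have hq : 1 ≤ R / r := (one_le_div hr0).2 hrR.le
  have hqε : 1 ≤ (R / r) ^ ε := Real.one_le_rpow hq hε.le
  rcases lt_or_ge R δ with h | h
  · obtain ⟨h1, h2⟩ := hδ R hR0 h
    have habs : 0 < |Real.log R| := by
      by_contra! h0
      rw [le_antisymm h0 (abs_nonneg _), Real.log_zero] at h1
      linarith
    have h3 : |Real.log R| ≤ (R / r) ^ ε := by
      rw [← Real.log_le_log_iff habs (by positivity), Real.log_rpow (by positivity),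
        log_div_of_eq_rpow hR0 hR1 hr]
      calc Real.log |Real.log R| = ε * (ε⁻¹ * Real.log |Real.log R|) := by field_simp
        _ ≤ ε * (φ R * |Real.log R|) := by gcongr
    calc |Real.log R| ≤ 1 * (R / r) ^ ε := by rwa [one_mul]
      _ ≤ _ := by gcongr; exact le_add_of_nonneg_right (abs_nonneg _)
  · have h3 : |Real.log R| ≤ |Real.log δ| := by
      rw [abs_of_nonpos (Real.log_nonpos hR0.le hR1.le),
        abs_of_nonpos (Real.log_nonpos hδ0.le hδ1.le)]
      exact neg_le_neg (Real.log_le_log hδ0 h)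
    calc |Real.log R| ≤ (1 + |Real.log δ|) * 1 := by linarith
      _ ≤ _ := by gcongr

lemma exists_natCast_le_mul_rpow {ε : ℝ} (hε : 0 < ε) :
    ∃ A : ℝ, 0 < A ∧ ∀ (l : ℕ) (q : ℝ), 1 ≤ q → 2 ^ l ≤ 2 * q → (l : ℝ) ≤ A * q ^ ε := by
  have hlog2 : 0 < Real.log 2 := Real.log_pos one_lt_two
  refine ⟨2 ^ ε / ε / Real.log 2, by positivity, fun l q hq hl => ?_⟩
  have hq0 : 0 ≤ q := zero_le_one.trans hq
  have h1 : l * Real.log 2 ≤ Real.log (2 * q) := by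
    rw [← Real.log_pow]
    exact Real.log_le_log (by positivity) hl
  have h2 := Real.log_le_rpow_div (x := 2 * q) (by positivity) hε
  rw [Real.mul_rpow zero_le_two hq0] at h2
  rw [div_mul_eq_mul_div, le_div_iff₀ hlog2, div_mul_eq_mul_div]
  exact h1.trans h2

lemma pow_le_rpow_logb {b q : ℝ} (hb : 1 ≤ b) (l : ℕ) (hq : 2 ^ l ≤ 2 * q) :
    b ^ l ≤ (2 * q) ^ Real.logb 2 b := by
  have hb0 : 0 < b := zero_lt_one.trans_le hb
  have h1 : b ^ l = ((2 : ℝ) ^ l) ^ Real.logb 2 b := by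
    rw [← Real.rpow_natCast 2 l, ← Real.rpow_mul zero_le_two, mul_comm,
      Real.rpow_mul zero_le_two, Real.rpow_logb two_pos (by norm_num) hb0, Real.rpow_natCast]
  rw [h1]
  exact Real.rpow_le_rpow (by positivity) hq (Real.logb_nonneg one_lt_two hb)

/-! ### Box and Assouad bounds for sets of infinite words -/

section Boundary

variable {F : Set (ℕ → ℕ)} {C b : ℝ}

/-- The factor `b ^ l` contributes `(R / r) ^ β`; the polynomial factor `n + l + 1` is absorbed into
`(R / r) ^ (s - β)`. -/
lemma phiAssouadDim_le {φ : ℝ → ℝ} (hφ : IsDimensionFunction φ)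
    (hω : (fun x : ℝ => Real.log |Real.log x| / |Real.log x|) =o[𝓝[>] 0] φ) (hC : 0 < C)
    (hb : 1 ≤ b) (hF : ∀ n l : ℕ, ∀ x ∈ F,
      ((pathPrefix (n + l) '' (F ∩ {y | pathPrefix n y = pathPrefix n x})).encard : ℝ≥0∞)
        ≤ ENNReal.ofReal (C * (n + l + 1) * b ^ l)) {s : ℝ} (hs : Real.logb 2 b < s) :
    phiAssouadDim φ F ≤ s := by
  set β := Real.logb 2 b with hβ
  have hβ0 : 0 ≤ β := Real.logb_nonneg one_lt_two hb
  have hε : 0 < s - β := by linarith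
  obtain ⟨A₁, hA₁, h1⟩ := exists_abs_log_le hφ hω hε
  obtain ⟨A₂, hA₂, h2⟩ := exists_natCast_le_mul_rpow hε
  have hlog2 : 0 < Real.log 2 := Real.log_pos one_lt_two
  refine sInf_le ⟨s, ⟨C * (2 + A₁ / Real.log 2 + A₂) * 2 ^ β, by positivity, ?_⟩, rfl⟩
  intro R r hr0 hr hrR hR1
  have hR0 : 0 < R := hr0.trans hrR
  have hq1 : 1 ≤ R / r := (one_le_div hr0).2 hrR.le
  have hq0 : 0 < R / r := zero_lt_one.trans_le hq1
  refine iSup₂_le fun x hx => ?_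
  obtain ⟨k, -, hk1, hk2⟩ := exists_level hr0 (hrR.trans hR1)
  obtain ⟨n, hn, hn1, hn2⟩ := exists_level hR0 hR1
  obtain ⟨l, rfl⟩ := Nat.exists_eq_add_of_le (level_le_level hrR.le hk1 hn2)
  rw [coverCount_eq_encard hk1 hk2, closedBall_eq_cylinder hn1 hn2]
  refine (hF n l x hx).trans (ENNReal.ofReal_le_ofReal ?_)
  have hl : (2 : ℝ) ^ l ≤ 2 * (R / r) := by
    rw [← mul_div_assoc, le_div_iff₀ hr0]
    calc (2 : ℝ) ^ l * r ≤ 2 ^ l * (2 * (1 / 2) ^ (n + l)) := by gcongr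
      _ = 2 * (1 / 2) ^ n * ((2 * (1 / 2)) ^ l) := by rw [mul_pow, pow_add]; ring
      _ = 2 * (1 / 2) ^ n := by norm_num
      _ ≤ 2 * R := by gcongr
  have hlA := h2 l (R / r) hq1 hl
  have hnA : (n : ℝ) ≤ 1 + A₁ / Real.log 2 * (R / r) ^ (s - β) := by
    have h3 : Real.log R ≤ Real.log (2 * (1 / 2) ^ n) := Real.log_le_log hR0 hn2.le
    rw [Real.log_mul two_ne_zero (by positivity), Real.log_pow, one_div, Real.log_inv] at h3
    have h4 : (n - 1) * Real.log 2 ≤ |Real.log R| := by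
      have := neg_abs_le (Real.log R)
      linarith
    have h5 := h4.trans (h1 R r hr0 hr hrR hR1)
    rw [← le_div_iff₀ hlog2] at h5
    rw [div_mul_eq_mul_div]
    linarith
  have hqe : 1 ≤ (R / r) ^ (s - β) := Real.one_le_rpow hq1 hε.le
  have hsum : (n : ℝ) + l + 1 ≤ (2 + A₁ / Real.log 2 + A₂) * (R / r) ^ (s - β) := by
    nlinarith
  have hbl := pow_le_rpow_logb hb l hl
  rw [Real.mul_rpow zero_le_two hq0.le] at hbl
  calc C * (n + l + 1) * b ^ l
      ≤ C * ((2 + A₁ / Real.log 2 + A₂) * (R / r) ^ (s - β)) * (2 ^ β * (R / r) ^ β) := by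
        gcongr
    _ = C * (2 + A₁ / Real.log 2 + A₂) * 2 ^ β * ((R / r) ^ (s - β) * (R / r) ^ β) := by ring
    _ = _ := by rw [← Real.rpow_add hq0, sub_add_cancel]

lemma exists_coverCount_le (hC : 0 < C) (hb : 1 ≤ b) (hF : ∀ l : ℕ,
      ((pathPrefix l '' F).encard : ℝ≥0∞) ≤ ENNReal.ofReal (C * (l + 1) * b ^ l))
    {t : ℝ} (ht : Real.logb 2 b < t) :
    ∃ C' : ℝ, 0 < C' ∧
      ∀ r, 0 < r → r < 1 → coverCount r F ≤ ENNReal.ofReal (C' * r ^ (-t)) := by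
  set β := Real.logb 2 b with hβ
  have hβ0 : 0 ≤ β := Real.logb_nonneg one_lt_two hb
  have hε : 0 < t - β := by linarith
  obtain ⟨A, hA, h2⟩ := exists_natCast_le_mul_rpow hε
  refine ⟨C * (A + 1) * 2 ^ β, by positivity, fun r h0 h1 => ?_⟩
  obtain ⟨k, -, hk1, hk2⟩ := exists_level h0 h1
  rw [coverCount_eq_encard hk1 hk2]
  refine (hF k).trans (ENNReal.ofReal_le_ofReal ?_)
  have hq1 : 1 ≤ r⁻¹ := (one_le_inv₀ h0).2 h1.le
  have hq0 : 0 < r⁻¹ := inv_pos.2 h0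
  have hk : (2 : ℝ) ^ k ≤ 2 * r⁻¹ := by
    rw [← div_eq_mul_inv, le_div_iff₀ h0]
    calc (2 : ℝ) ^ k * r ≤ 2 ^ k * (2 * (1 / 2) ^ k) := by gcongr
      _ = 2 * (2 * (1 / 2)) ^ k := by rw [mul_pow]; ring
      _ = 2 := by norm_num
  have hkA := h2 k r⁻¹ hq1 hk
  have hqe : 1 ≤ r⁻¹ ^ (t - β) := Real.one_le_rpow hq1 hε.le
  have hsum : (k : ℝ) + 1 ≤ (A + 1) * r⁻¹ ^ (t - β) := by linarith
  have hbk := pow_le_rpow_logb hb k hk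
  rw [Real.mul_rpow zero_le_two hq0.le] at hbk
  calc C * (k + 1) * b ^ k
      ≤ C * ((A + 1) * r⁻¹ ^ (t - β)) * (2 ^ β * r⁻¹ ^ β) := by gcongr
    _ = C * (A + 1) * 2 ^ β * (r⁻¹ ^ (t - β) * r⁻¹ ^ β) := by ring
    _ = _ := by
        rw [← Real.rpow_add hq0, sub_add_cancel, Real.inv_rpow h0.le, Real.rpow_neg h0.le]

lemma exists_le_coverCount {c : List ℕ → ℕ} {a t : ℝ} (ht : 0 < t) (ha : a = (1 / 2 : ℝ) ^ t)
    (hc : minContent (ENNReal.ofReal a) c ≠ 0) :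
    ∃ K : ℝ, 0 < K ∧ ∀ r, 0 < r → r < 1 →
      ENNReal.ofReal (K * r ^ (-t)) ≤ coverCount r (gromovBoundary c) := by
  have ha0 : 0 < a := by rw [ha]; positivity
  have htop : minContent (ENNReal.ofReal a) c ≠ ∞ :=
    ((minContent_le_one _ _).trans_lt ENNReal.one_lt_top).ne
  refine ⟨(minContent (ENNReal.ofReal a) c).toReal, ENNReal.toReal_pos hc htop, fun r h0 h1 => ?_⟩
  obtain ⟨k, -, hk1, hk2⟩ := exists_level h0 h1
  rw [coverCount_eq_encard hk1 hk2, ENNReal.ofReal_mul ENNReal.toReal_nonneg,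
    ENNReal.ofReal_toReal htop]
  have hak : a ^ k ≤ r ^ t := by
    rw [ha, ← Real.rpow_natCast, ← Real.rpow_mul (by norm_num), mul_comm,
      Real.rpow_mul (by norm_num), Real.rpow_natCast]
    exact Real.rpow_le_rpow (by positivity) hk1 ht.le
  calc minContent (ENNReal.ofReal a) c * ENNReal.ofReal (r ^ (-t))
      ≤ ((pathPrefix k '' gromovBoundary c).encard : ℝ≥0∞) * ENNReal.ofReal a ^ k
          * ENNReal.ofReal (r ^ (-t)) := by
        gcongr
        exact minContent_le_encard_mul ENNReal.ofReal_ne_top c k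
    _ ≤ ((pathPrefix k '' gromovBoundary c).encard : ℝ≥0∞) * 1 := by
        rw [mul_assoc]
        gcongr
        rw [← ENNReal.ofReal_pow ha0.le, ← ENNReal.ofReal_mul (by positivity),
          ENNReal.ofReal_le_one]
        calc a ^ k * r ^ (-t) ≤ r ^ t * r ^ (-t) := by gcongr
          _ = 1 := by rw [← Real.rpow_add h0, add_neg_cancel, Real.rpow_zero]
    _ = _ := mul_one _

/-- If an exponent `s < t` were admissible, chaining the local bounds along the scales `R ↦ R ^ (1 +
φ R)` would make the global covering numbers grow with exponent below `t` along a sequence of radii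
tending to `0`. -/
lemma le_phiAssouadDim {φ : ℝ → ℝ} (hφ : IsDimensionFunction φ)
    (hω : (fun x : ℝ => Real.log |Real.log x| / |Real.log x|) =o[𝓝[>] 0] φ)
    (hfin : ∀ r, 0 < r → r < 1 → coverCount r F ≠ ∞) {K t : ℝ} (hK : 0 < K)
    (hF : ∀ r, 0 < r → r < 1 → ENNReal.ofReal (K * r ^ (-t)) ≤ coverCount r F) :
    t ≤ phiAssouadDim φ F := by
  refine le_sInf ?_
  rintro _ ⟨s, ⟨C, hC, hs⟩, rfl⟩
  refine EReal.coe_le_coe_iff.2 ?_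
  by_contra! hst
  set ε := (t - s) / 2 with hε
  have hε0 : 0 < ε := by rw [hε]; linarith
  -- As `log |log R| ≥ 1` below `δ`, this `M` gives `log (R / r) ≥ 1`, so the scales tend to `0`,
  -- and `C ≤ (R / r) ^ ε`, so the constants do not accumulate.
  obtain ⟨δ, hδ0, hδ1, hδ⟩ := exists_dimensionFunction_bound hφ hω
    (M := max 1 (Real.log C / ε)) (by positivity)
  have hstep : ∀ R, 0 < R → R < δ → 0 < R ^ (1 + φ R) ∧ R ^ (1 + φ R) < R ∧
      -Real.log R + 1 ≤ -Real.log (R ^ (1 + φ R)) ∧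
      coverCount (R ^ (1 + φ R)) F ≤ coverCount R F *
        ENNReal.ofReal (Real.exp ((s + ε) * (-Real.log (R ^ (1 + φ R)) - -Real.log R))) := by
    intro R hR0 hRδ
    have hR1 : R < 1 := hRδ.trans hδ1
    set r := R ^ (1 + φ R) with hr
    have hr0 : 0 < r := Real.rpow_pos_of_pos hR0 _
    obtain ⟨h1, h2⟩ := hδ R hR0 hRδ
    have h3 : max 1 (Real.log C / ε) ≤ φ R * |Real.log R| := by
      refine le_trans ?_ h2
      exact le_mul_of_one_le_right (by positivity) h1
    have hlog := log_div_of_eq_rpow hR0 hR1 hr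
    have hlog' := Real.log_div hR0.ne' hr0.ne'
    have h4 : 1 ≤ Real.log (R / r) := hlog ▸ (le_max_left _ _).trans h3
    have h5 : Real.log C ≤ ε * Real.log (R / r) := by
      rw [mul_comm, ← div_le_iff₀ hε0, hlog]
      exact (le_max_right _ _).trans h3
    have hrR : r < R := by
      rw [← Real.log_lt_log_iff hr0 hR0]; linarith
    refine ⟨hr0, hrR, by linarith, ?_⟩
    refine (coverCount_le_mul hr0 hrR hR1 (hfin R hR0 hR1) fun x hx =>
      (le_iSup₂ (f := fun x (_ : x ∈ F) => coverCount r (F ∩ Metric.closedBall x R)) x hx).trans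
        (hs R r hr0 hr hrR hR1)).trans ?_
    gcongr
    have hq : 0 < R / r := div_pos hR0 hr0
    rw [Real.rpow_def_of_pos hq]
    nth_rewrite 1 [← Real.exp_log hC]
    rw [← Real.exp_add, Real.exp_le_exp]
    have h6 : -Real.log r - -Real.log R = Real.log (R / r) := by rw [hlog']; ring
    rw [h6]
    linarith
  let R : ℕ → ℝ := fun j => (fun x => x ^ (1 + φ x))^[j] (δ / 2)
  have hRsucc : ∀ j, R (j + 1) = R j ^ (1 + φ (R j)) := fun j =>
    Function.iterate_succ_apply' _ _ _
  have hR : ∀ j, 0 < R j ∧ R j < δ := by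
    intro j
    induction j with
    | zero => exact ⟨half_pos hδ0, half_lt_self hδ0⟩
    | succ j ih =>
      obtain ⟨h1, h2, -, -⟩ := hstep (R j) ih.1 ih.2
      rw [hRsucc]
      exact ⟨h1, h2.trans ih.2⟩
  have hy : ∀ j : ℕ, (j : ℝ) ≤ -Real.log (R j) := by
    intro j
    induction j with
    | zero =>
      have := Real.log_nonpos (hR 0).1.le ((hR 0).2.trans hδ1).le
      simpa using this
    | succ j ih =>
      obtain ⟨-, -, h3, -⟩ := hstep (R j) (hR j).1 (hR j).2
      rw [hRsucc]
      push_cast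
      linarith
  set N₀ := coverCount (R 0) F with hN₀
  have hN₀top : N₀ ≠ ∞ := hfin _ (hR 0).1 ((hR 0).2.trans hδ1)
  have hcount : ∀ j, coverCount (R j) F
      ≤ N₀ * ENNReal.ofReal (Real.exp ((s + ε) * (-Real.log (R j) - -Real.log (R 0)))) := by
    intro j
    induction j with
    | zero => simp [hN₀]
    | succ j ih =>
      obtain ⟨-, -, -, h4⟩ := hstep (R j) (hR j).1 (hR j).2
      rw [← hRsucc] at h4
      refine h4.trans ((mul_le_mul_left ih _).trans_eq ?_)
      rw [mul_assoc, ← ENNReal.ofReal_mul (Real.exp_pos _).le, ← Real.exp_add]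
      congr 3
      ring
  -- Since `t = (s + ε) + ε`, comparing the two bounds at `R j` leaves a factor `exp (ε * -log (R
  -- j)) ≥ ε * j`, which is unbounded.
  have hreal : ∀ j : ℕ, K * (ε * j) ≤ N₀.toReal * Real.exp ((s + ε) * Real.log (R 0)) := by
    intro j
    have h1 := (hF (R j) (hR j).1 ((hR j).2.trans hδ1)).trans (hcount j)
    rw [← ENNReal.ofReal_toReal hN₀top, ← ENNReal.ofReal_mul ENNReal.toReal_nonneg,
      ENNReal.ofReal_le_ofReal_iff (by positivity), Real.rpow_def_of_pos (hR j).1] at h1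
    have h2 : Real.exp (Real.log (R j) * -t)
        = Real.exp (ε * -Real.log (R j)) * Real.exp ((s + ε) * -Real.log (R j)) := by
      rw [← Real.exp_add]; congr 1; rw [hε]; ring
    have h3 : Real.exp ((s + ε) * (-Real.log (R j) - -Real.log (R 0)))
        = Real.exp ((s + ε) * Real.log (R 0)) * Real.exp ((s + ε) * -Real.log (R j)) := by
      rw [← Real.exp_add]; congr 1; ring
    rw [h2, h3, ← mul_assoc, ← mul_assoc] at h1
    have h4 := le_of_mul_le_mul_right h1 (Real.exp_pos _)
    refine le_trans ?_ h4
    gcongr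
    calc ε * (j : ℝ) ≤ ε * -Real.log (R j) := by gcongr; exact hy j
      _ ≤ Real.exp (ε * -Real.log (R j)) := by
        linarith [Real.add_one_le_exp (ε * -Real.log (R j))]
  obtain ⟨j, hj⟩ := exists_nat_gt
    (N₀.toReal * Real.exp ((s + ε) * Real.log (R 0)) / (K * ε))
  rw [div_lt_iff₀ (by positivity)] at hj
  have := hreal j
  linarith

end Boundary

/-! ### From the two almost sure statements to the theorem -/

lemma forall_mem_pathPrefix_lt {c : List ℕ → ℕ} {N : ℕ} (hc : ∀ v, c v ≤ N) {x : ℕ → ℕ}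
    (hx : x ∈ gromovBoundary c) (n : ℕ) : ∀ i ∈ pathPrefix n x, i < N := by
  intro i hi
  obtain ⟨k, rfl⟩ := (List.mem_ofFn' _ _).1 hi
  exact (mem_gromovBoundary.1 hx k).trans_le (hc _)

/-- The dimensions of the boundary of a tree with bounded degrees, positive contents for all
`a > 1 / m` and uniform growth bounds for all rates `b > m`. -/
lemma dims_gromovBoundary_eq {φ : ℝ → ℝ} (hφ : IsDimensionFunction φ)
    (hω : (fun x : ℝ => Real.log |Real.log x| / |Real.log x|) =o[𝓝[>] 0] φ)
    {m : ℝ} (hm : 1 < m) {N : ℕ} {c : List ℕ → ℕ} (hc : ∀ v, c v ≤ N)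
    (hlow : ∀ a : ℝ, 0 < a → a < 1 → 1 < a * m → minContent (ENNReal.ofReal a) c ≠ 0)
    (hup : ∀ b : ℝ, m < b → ∃ C : ℝ, 0 < C ∧ ∀ u : List ℕ, (∀ i ∈ u, i < N) → ∀ l : ℕ,
      (genCount l (descTree c u) : ℝ) ≤ C * (u.length + l + 1) * b ^ l) :
    phiAssouadDim φ (gromovBoundary c) = Real.logb 2 m ∧
      lowerBoxDim (gromovBoundary c) = Real.logb 2 m ∧
      upperBoxDim (gromovBoundary c) = Real.logb 2 m ∧
      ((dimH (gromovBoundary c) : ℝ≥0∞) : EReal) = Real.logb 2 m := by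
  set F := gromovBoundary c with hF
  set L := Real.logb 2 m with hL
  have hm0 : 0 < m := one_pos.trans hm
  have hL0 : 0 < L := Real.logb_pos one_lt_two hm
  have hcount : ∀ b : ℝ, m < b → ∃ C : ℝ, 0 < C ∧ ∀ n l : ℕ, ∀ x ∈ F,
      ((pathPrefix (n + l) '' (F ∩ {y | pathPrefix n y = pathPrefix n x})).encard : ℝ≥0∞)
        ≤ ENNReal.ofReal (C * (n + l + 1) * b ^ l) := by
    intro b hb
    obtain ⟨C, hC, h⟩ := hup b hb
    refine ⟨C, hC, fun n l x hx => ?_⟩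
    have h1 := h _ (forall_mem_pathPrefix_lt hc hx n) l
    rw [length_pathPrefix] at h1
    refine (ENat.toENNReal_le.2 (encard_image_pathPrefix_cylinder_le c n l x)).trans ?_
    rw [ENat.toENNReal_coe, ← ENNReal.ofReal_natCast]
    exact ENNReal.ofReal_le_ofReal h1
  have hcover : ∀ t : ℝ, L < t → ∃ C : ℝ, 0 < C ∧ ∀ r, 0 < r → r < 1 →
      coverCount r F ≤ ENNReal.ofReal (C * r ^ (-t)) := by
    intro t ht
    have hmt : m < 2 ^ t := (Real.logb_lt_iff_lt_rpow one_lt_two hm0).1 ht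
    obtain ⟨b, hmb, hbt⟩ := exists_between hmt
    obtain ⟨C, hC, h⟩ := hup b hmb
    refine exists_coverCount_le hC (hm.trans hmb).le (fun l => ?_)
      ((Real.logb_lt_iff_lt_rpow one_lt_two (hm0.trans hmb)).2 hbt)
    have h1 := h [] (by simp) l
    refine (ENat.toENNReal_le.2 (encard_image_pathPrefix_le c l)).trans ?_
    rw [ENat.toENNReal_coe, ← ENNReal.ofReal_natCast]
    refine ENNReal.ofReal_le_ofReal ?_
    have h2 : descTree c [] = c := rfl
    simpa [h2] using h1
  have hcontent : ∀ t : ℝ, 0 < t → t < L →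
      minContent (ENNReal.ofReal ((1 / 2 : ℝ) ^ t)) c ≠ 0 := by
    intro t ht0 ht
    refine hlow _ (by positivity) (Real.rpow_lt_one (by norm_num) (by norm_num) ht0) ?_
    have h1 : (2 : ℝ) ^ t < m := (Real.lt_logb_iff_rpow_lt one_lt_two hm0).1 ht
    rw [one_div, Real.inv_rpow zero_le_two, inv_mul_eq_div, one_lt_div (by positivity)]
    exact h1
  have hlower : ∀ t : ℝ, 0 < t → t < L → ∃ K : ℝ, 0 < K ∧ ∀ r, 0 < r → r < 1 →
      ENNReal.ofReal (K * r ^ (-t)) ≤ coverCount r F := fun t ht0 ht =>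
    exists_le_coverCount ht0 rfl (hcontent t ht0 ht)
  have hfin : ∀ r, 0 < r → r < 1 → coverCount r F ≠ ∞ := by
    intro r h0 h1
    obtain ⟨C, -, h⟩ := hcover (L + 1) (by linarith)
    exact ne_top_of_le_ne_top ENNReal.ofReal_ne_top (h r h0 h1)
  have upper : ∀ d : EReal, (∀ s : ℝ, L < s → d ≤ s) → d ≤ L := fun d hd =>
    EReal.le_of_forall_lt_iff_le.1 fun s hs => hd s (EReal.coe_lt_coe_iff.1 hs)
  have lower : ∀ d : EReal, (∀ s : ℝ, 0 < s → s < L → (s : EReal) ≤ d) → (L : EReal) ≤ d := by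
    intro d hd
    refine EReal.ge_of_forall_gt_iff_ge.1 fun s hs => ?_
    have hs' : s < L := EReal.coe_lt_coe_iff.1 hs
    -- Only positive exponents are available, so `s` is raised to `max s (L / 2)`, still below `L`.
    exact (EReal.coe_le_coe_iff.2 (le_max_left s (L / 2))).trans
      (hd _ (lt_max_of_lt_right (by linarith)) (max_lt hs' (by linarith)))
  have hupperBox : upperBoxDim F ≤ L := by
    refine upper _ fun s hs => ?_
    obtain ⟨t, ht, hts⟩ := exists_between hs
    obtain ⟨C, hC, h⟩ := hcover t ht
    exact upperBoxDim_le hC h hts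
  have hlowerBox : (L : EReal) ≤ lowerBoxDim F := by
    refine lower _ fun s hs0 hs => ?_
    obtain ⟨t, hst, ht⟩ := exists_between hs
    obtain ⟨K, hK, h⟩ := hlower t (hs0.trans hst) ht
    exact le_lowerBoxDim hK h hst
  have hbox : lowerBoxDim F ≤ upperBoxDim F := lowerBoxDim_le_upperBoxDim
  refine ⟨le_antisymm ?_ ?_, le_antisymm (hbox.trans hupperBox) hlowerBox,
    le_antisymm hupperBox (hlowerBox.trans hbox), le_antisymm ?_ ?_⟩
  · refine upper _ fun s hs => ?_
    have hms : m < 2 ^ s := (Real.logb_lt_iff_lt_rpow one_lt_two hm0).1 hs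
    obtain ⟨b, hmb, hbs⟩ := exists_between hms
    obtain ⟨C, hC, h⟩ := hcount b hmb
    exact phiAssouadDim_le hφ hω hC (hm.trans hmb).le h
      ((Real.logb_lt_iff_lt_rpow one_lt_two (hm0.trans hmb)).2 hbs)
  · refine lower _ fun s hs0 hs => ?_
    obtain ⟨K, hK, h⟩ := hlower s hs0 hs
    exact le_phiAssouadDim hφ hω hfin hK h
  · refine upper _ fun s hs => ?_
    obtain ⟨C, hC, h⟩ := hcover s hs
    have h1 := dimH_le_of_coverCount_le (s := ⟨s, (hL0.trans hs).le⟩) hC h le_rfl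
    exact (EReal.coe_ennreal_le_coe_ennreal_iff.2 h1).trans_eq (EReal.coe_nnreal_eq_coe_real _)
  · refine lower _ fun s hs0 hs => ?_
    have h1 := le_dimH_gromovBoundary (s := ⟨s, hs0.le⟩) hs0 rfl (hcontent s hs0 hs)
    exact (EReal.coe_nnreal_eq_coe_real _).symm.trans_le
      (EReal.coe_ennreal_le_coe_ennreal_iff.2 h1)

theorem mainTheorem6 {Ω : Type*} [MeasurableSpace Ω] (P : Measure Ω) [IsProbabilityMeasure P]
    (N : ℕ) (θ : PMF ℕ) (hθ : ∀ j, N < j → θ j = 0)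
    (hsuper : 1 < ∑ k ∈ Finset.Icc 1 N, (θ k).toReal * (k : ℝ))
    (X : List ℕ → Ω → ℕ) (hmeas : ∀ u, Measurable (X u)) (hindep : iIndepFun X P)
    (hlaw : ∀ u, P.map (X u) = θ.toMeasure)
    (φ : ℝ → ℝ) (hφ : IsDimensionFunction φ)
    (hω : (fun x : ℝ => Real.log |Real.log x| / |Real.log x|) =o[𝓝[>] 0] φ) :
    ∀ᵐ ω ∂P, (∀ k, 0 < generationSize (fun u => X u ω) k) →
      phiAssouadDim φ (gromovBoundary fun u => X u ω)
          = upperBoxDim (gromovBoundary fun u => X u ω) ∧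
      lowerBoxDim (gromovBoundary fun u => X u ω)
          = upperBoxDim (gromovBoundary fun u => X u ω) ∧
      upperBoxDim (gromovBoundary fun u => X u ω)
          = ((dimH (gromovBoundary fun u => X u ω) : ℝ≥0∞) : EReal) := by
  set m : ℝ := ∑ k ∈ Finset.Icc 1 N, (θ k).toReal * (k : ℝ) with hm
  have hm' : m = ∑ j ∈ Finset.range (N + 1), (θ j).toReal * j := by
    rw [hm]
    refine Finset.sum_subset (fun k hk => ?_) fun k hk hk' => ?_
    · rw [Finset.mem_Icc] at hk
      exact Finset.mem_range.2 (by omega)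
    · have : k = 0 := by
        rw [Finset.mem_range] at hk
        rw [Finset.mem_Icc] at hk'
        omega
      simp [this]
  have hmap : P.map (fun ω u => X u ω) = gwMeasure θ := by
    rw [hindep.map_fun_eq_infinitePi_map hmeas]
    simp_rw [hlaw]
    rfl
  -- Rational parameters leave countably many null sets; monotonicity in `a`, and in `b` below,
  -- recovers all real ones.
  have hlow : ∀ᵐ c ∂gwMeasure θ, ∀ a : ℚ, 0 < (a : ℝ) → (a : ℝ) < 1 → 1 < (a : ℝ) * m →
      minContent 1 c ≠ 0 → minContent (ENNReal.ofReal a) c ≠ 0 := by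
    refine ae_all_iff.2 fun a => ?_
    by_cases ha : 0 < (a : ℝ) ∧ (a : ℝ) < 1 ∧ 1 < (a : ℝ) * m
    · filter_upwards [ae_minContent_ne_zero θ hθ hm' ha.1 ha.2.1 ha.2.2] with c hc _ _ _
      exact hc
    · exact Eventually.of_forall fun c h0 h1 h2 => absurd ⟨h0, h1, h2⟩ ha
  have hup : ∀ᵐ c ∂gwMeasure θ, ∀ b : ℚ, m < (b : ℝ) → ∃ C : ℝ, 0 < C ∧
      ∀ u : List ℕ, (∀ i ∈ u, i < N) → ∀ l : ℕ,
        (genCount l (descTree c u) : ℝ) ≤ C * (u.length + l + 1) * (b : ℝ) ^ l := by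
    refine ae_all_iff.2 fun b => ?_
    by_cases hb : m < (b : ℝ)
    · filter_upwards [ae_exists_genCount_descTree_le θ hθ hm' (hsuper.trans hb).le hb] with c hc _
      exact hc
    · exact Eventually.of_forall fun c h => absurd h hb
  have hae : ∀ᵐ c ∂gwMeasure θ, (∀ k, 0 < generationSize c k) →
      phiAssouadDim φ (gromovBoundary c) = upperBoxDim (gromovBoundary c) ∧
      lowerBoxDim (gromovBoundary c) = upperBoxDim (gromovBoundary c) ∧
      upperBoxDim (gromovBoundary c) = ((dimH (gromovBoundary c) : ℝ≥0∞) : EReal) := by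
    filter_upwards [hlow, hup, ae_forall_le θ hθ] with c h1 h2 h3 hsurv
    have hlow' : ∀ a : ℝ, 0 < a → a < 1 → 1 < a * m → minContent (ENNReal.ofReal a) c ≠ 0 := by
      intro a ha0 ha1 ham
      have hlt : max 0 (1 / m) < a := max_lt ha0 ((div_lt_iff₀ (one_pos.trans hsuper)).2 ham)
      obtain ⟨q, hq1, hq2⟩ := exists_rat_btwn hlt
      have hq0 : 0 < (q : ℝ) := (le_max_left _ _).trans_lt hq1
      have hqm : 1 < (q : ℝ) * m :=
        (div_lt_iff₀ (one_pos.trans hsuper)).1 ((le_max_right _ _).trans_lt hq1)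
      have h4 := h1 q hq0 (hq2.trans ha1) hqm (minContent_one_ne_zero hsurv)
      exact fun h0 => h4 (le_antisymm
        ((minContent_mono (ENNReal.ofReal_le_ofReal hq2.le) c).trans_eq h0) bot_le)
    have hup' : ∀ b : ℝ, m < b → ∃ C : ℝ, 0 < C ∧ ∀ u : List ℕ, (∀ i ∈ u, i < N) → ∀ l : ℕ,
        (genCount l (descTree c u) : ℝ) ≤ C * (u.length + l + 1) * b ^ l := by
      intro b hb
      obtain ⟨q, hq1, hq2⟩ := exists_rat_btwn hb
      obtain ⟨C, hC, h⟩ := h2 q hq1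
      refine ⟨C, hC, fun u hu l => (h u hu l).trans ?_⟩
      have hq0 : 0 ≤ (q : ℝ) := ((one_pos.trans hsuper).trans hq1).le
      gcongr
    obtain ⟨e1, e2, e3, e4⟩ := dims_gromovBoundary_eq hφ hω hsuper h3 hlow' hup'
    rw [e1, e2, e3, e4]
    exact ⟨rfl, rfl, rfl⟩
  rw [← hmap] at hae
  exact ae_of_ae_map (measurable_pi_lambda _ hmeas).aemeasurable hae
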